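/- Let $(E,\mathcal E)$ be a Borel (standard Borel) space, $\alpha$ a finite measure on $E$ and $p\in(0,1)$. Let $\mathbf N_{<\infty}$ be the space of finite counting measures on $E$ (measures $\eta$ with $\eta(B)\in\mathbb N_0$ for all $B\in\mathcal E$), with the $\sigma$-algebra generated by the maps $\eta\mapsto\eta(B)$, $B\in\mathcal E$. Let $\rho_{p,\alpha}$ be the law of the Pascal point process, that is, the unique probability measure on $\mathbf N_{<\infty}$ such that $$\rho_{p,\alpha}(\{\eta:\eta(B)=n\})=(1-p)^{\alpha(B)}\frac{p^n}{n!}\,\alpha(B)(\alpha(B)+1)\cdots(\alpha(B)+n-1)$$ for all $B\in\mathcal E$, $n\in\mathbb N_0$, and such that $\eta(B_1),\dots,\eta(B_n)$ are independent under $\rho_{p,\alpha}$ for all $n\ge 2$ and pairwise disjoint $B_1,\dots,B_n\in\mathcal E$. Let $\mathcal H=L^2(\mathbf N_{<\infty},\rho_{p,\alpha};\mathbb C)$, and let $\mathcal D\subset\mathcal H$ be the set of (classes of) bounded measurable functions $F$ for which there is $m\in\mathbb N$ such that $F$ vanishes outside $\{\eta:\eta(E)\le m\}$. Define $k^{\pm}(\mathbf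 1):\mathcal D\to\mathcal D$ by $$k^+(\mathbf 1)F(\eta)=\frac1{\sqrt p}\int F(\eta-\delta_x)\,\eta(\mathrm dx),\qquad k^-(\mathbf 1)F(\eta)=\sqrt p\int F(\eta+\delta_x)\,(\alpha+\eta)(\mathrm dx).$$ Then, for every $\xi\in\mathbb C$, the operator $A=\frac1{\mathrm i}\bigl(\xi k^+(\mathbf 1)-\overline{\xi}\,k^-(\mathbf 1)\bigr)$ in $\mathcal H$ with domain $\mathcal D$ is closable, and its closure is self-adjoint. Moreover, every $f\in\mathcal D$ is an analytic vector for $A$: there is $\varepsilon>0$ with $\sum_{n=0}^\infty\frac{\varepsilon^n}{n!}\|A^nf\|<\infty$. -/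

import Mathlib

open MeasureTheory ProbabilityTheory
open scoped ENNReal ComplexConjugate

noncomputable section

namespace Pascal

/-- A finite counting measure on `E`: a measure all of whose values on measurable sets are
nonnegative integers (in particular the total mass is finite). -/
structure Config (E : Type*) [MeasurableSpace E] where
  toMeasure : Measure E
  counting : ∀ B, MeasurableSet B → ∃ n : ℕ, toMeasure B = n

variable {E : Type*} [MeasurableSpace E]

/-- The σ-algebra generated by the counting variables `η ↦ η(B)`, `B` measurable. -/
instance : MeasurableSpace (Config E) :=
  ⨆ B : {B : Set E // MeasurableSet B},
    MeasurableSpace.comap (fun η : Config E => η.toMeasure B) inferInstance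

namespace Config

@[ext]
theorem ext {η ζ : Config E} (h : η.toMeasure = ζ.toMeasure) : η = ζ := by
  cases η; cases ζ; simpa using h

/-- The empty configuration. -/
instance : Zero (Config E) := ⟨⟨0, fun _ _ => ⟨0, by simp⟩⟩⟩

@[simp] theorem toMeasure_zero : (0 : Config E).toMeasure = 0 := rfl

/-- The configuration `η + δ_x`. -/
def add (η : Config E) (x : E) : Config E :=
  ⟨η.toMeasure + Measure.dirac x, fun B hB => by
    obtain ⟨n, hn⟩ := η.counting B hB
    by_cases hx : x ∈ B
    · exact ⟨n + 1, by simp [hn, Measure.dirac_apply' x hB, hx]⟩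
    · exact ⟨n, by simp [hn, Measure.dirac_apply' x hB, hx]⟩⟩

@[simp] theorem toMeasure_add (η : Config E) (x : E) :
    (η.add x).toMeasure = η.toMeasure + Measure.dirac x := rfl

open Classical in
/-- The configuration `η - δ_x`, for `x` a point of `η`. (If `η - δ_x` is not a counting
measure, the value is `η`; this does not happen for `η`-almost every `x`.) -/
def remove (η : Config E) (x : E) : Config E :=
  if h : ∀ B, MeasurableSet B → ∃ n : ℕ, (η.toMeasure - Measure.dirac x) B = n
  then ⟨η.toMeasure - Measure.dirac x, h⟩ else η

instance (η : Config E) : IsFiniteMeasure η.toMeasure :=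
  ⟨by obtain ⟨n, hn⟩ := η.counting Set.univ MeasurableSet.univ; simp [hn]⟩

theorem remove_add (η : Config E) (x : E) : (η.add x).remove x = η := by
  have h : (η.add x).toMeasure - Measure.dirac x = η.toMeasure := by
    simp
  ext1
  rw [remove, dif_pos (by rw [h]; exact η.counting)]
  exact h

theorem measurable_eval {B : Set E} (hB : MeasurableSet B) :
    Measurable (fun η : Config E => η.toMeasure B) :=
  Measurable.of_comap_le
    (le_iSup (fun B : {B : Set E // MeasurableSet B} =>
      MeasurableSpace.comap (fun η : Config E => η.toMeasure B) inferInstance) ⟨B, hB⟩)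

theorem measurable_toMeasure : Measurable (toMeasure : Config E → Measure E) :=
  Measure.measurable_of_measurable_coe _ fun _ hB => measurable_eval hB

theorem measurable_of_eval {X : Type*} [MeasurableSpace X] {f : X → Config E}
    (h : ∀ B, MeasurableSet B → Measurable fun a => (f a).toMeasure B) : Measurable f := by
  refine Measurable.of_le_map (iSup_le fun B => ?_)
  rw [← MeasurableSpace.comap_le_iff_le_map, MeasurableSpace.comap_comp]
  exact (h B B.2).comap_le

theorem measurable_add : Measurable fun q : Config E × E => q.1.add q.2 := by
  refine measurable_of_eval fun B hB => ?_
  simp only [toMeasure_add, Measure.coe_add, Pi.add_apply, Measure.dirac_apply' _ hB]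
  exact ((measurable_eval hB).comp measurable_fst).add
    ((measurable_one.indicator hB).comp measurable_snd)

/-- The kernel `η ↦ η(dx)`. -/
def kernel (E : Type*) [MeasurableSpace E] : Kernel (Config E) E :=
  ⟨toMeasure, measurable_toMeasure⟩

@[simp] theorem kernel_apply (η : Config E) : kernel E η = η.toMeasure := rfl

theorem measurableSet_eval_eq {B : Set E} (hB : MeasurableSet B) (c : ℝ≥0∞) :
    MeasurableSet {η : Config E | η.toMeasure B = c} :=
  measurable_eval hB (measurableSet_singleton c)

open Classical in
instance : IsSFiniteKernel (kernel E) := by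
  let κ : ℕ → Kernel (Config E) E := fun n =>
    Kernel.piecewise (measurableSet_eval_eq (E := E) MeasurableSet.univ (n : ℝ≥0∞)) (kernel E) 0
  refine ⟨κ, fun n => ⟨⟨n, by simp, fun η => ?_⟩⟩, ?_⟩
  · simp only [κ, Kernel.piecewise_apply]
    split_ifs with h
    · exact le_of_eq h
    · simp
  · ext η B hB
    obtain ⟨n, hn⟩ := η.counting Set.univ MeasurableSet.univ
    rw [Kernel.sum_apply' _ _ hB, tsum_eq_single n]
    · simp [κ, Kernel.piecewise_apply, hn]
    · intro m hm
      have : ¬ (n : ℝ≥0∞) = m := by exact_mod_cast hm.symm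
      simp [κ, Kernel.piecewise_apply, hn, this]

/-- The number of points of `η` in `B`, as a natural number. -/
def cnt (B : Set E) (η : Config E) : ℕ := ⌊(η.toMeasure B).toReal⌋₊

theorem cast_cnt {B : Set E} (hB : MeasurableSet B) (η : Config E) :
    (cnt B η : ℝ≥0∞) = η.toMeasure B := by
  obtain ⟨n, hn⟩ := η.counting B hB
  simp [cnt, hn]

theorem cnt_eq_iff {B : Set E} (hB : MeasurableSet B) (η : Config E) (n : ℕ) :
    cnt B η = n ↔ η.toMeasure B = n := by
  rw [← cast_cnt hB]; exact_mod_cast Iff.rfl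

theorem measurable_cnt {B : Set E} (hB : MeasurableSet B) :
    Measurable (cnt B : Config E → ℕ) :=
  Nat.measurable_floor.comp (measurable_eval hB).ennreal_toReal

/-- A nonzero counting measure on a standard Borel space has an atom. -/
theorem exists_atom [StandardBorelSpace E] (η : Config E) {B : Set E} (hB : MeasurableSet B)
    (h : η.toMeasure B ≠ 0) : ∃ x ∈ B, η.toMeasure {x} ≠ 0 := by
  classical
  have hex : ∃ n : ℕ, n ≠ 0 ∧ ∃ C ⊆ B, MeasurableSet C ∧ η.toMeasure C = n := by
    obtain ⟨n, hn⟩ := η.counting B hB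
    exact ⟨n, by rintro rfl; simp [hn] at h, B, subset_rfl, hB, hn⟩
  obtain ⟨hn0, C, hCB, hC, hCn⟩ := Nat.find_spec hex
  set n := Nat.find hex
  have key : ∀ U, MeasurableSet U → U ∈ ae (η.toMeasure.restrict C) ∨
      Uᶜ ∈ ae (η.toMeasure.restrict C) := by
    intro U hU
    by_contra! hcon
    simp only [mem_ae_iff, compl_compl, Measure.restrict_apply hU,
      Measure.restrict_apply hU.compl] at hcon
    obtain ⟨a, ha⟩ := η.counting (U ∩ C) (hU.inter hC)
    obtain ⟨b, hb⟩ := η.counting (Uᶜ ∩ C) (hU.compl.inter hC)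
    have ha0 : a ≠ 0 := by rintro rfl; exact hcon.2 (by simpa using ha)
    have hb0 : b ≠ 0 := by rintro rfl; exact hcon.1 (by simpa using hb)
    have h1 : n ≤ a := Nat.find_min' hex
      ⟨ha0, U ∩ C, Set.inter_subset_right.trans hCB, hU.inter hC, ha⟩
    have h2 : a + b = n := by
      have := measure_inter_add_sdiff (μ := η.toMeasure) C hU
      rw [Set.inter_comm, ha, hCn, Set.sdiff_eq, Set.inter_comm, hb] at this
      exact_mod_cast this
    omega
  have hne : C.Nonempty := by
    rw [Set.nonempty_iff_ne_empty]
    rintro rfl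
    rw [measure_empty] at hCn
    exact hn0 (by exact_mod_cast hCn.symm)
  have hCmem : C ∈ ae (η.toMeasure.restrict C) := ae_restrict_mem hC
  obtain ⟨x, hxC, hx⟩ := Filter.exists_mem_singleton_mem_of_mem_of_nonempty_of_forall_separating
    MeasurableSet hCmem hne key
  refine ⟨x, hCB hxC, fun h0 => hn0 ?_⟩
  have hx' : η.toMeasure ({x}ᶜ ∩ C) = 0 := by
    rwa [mem_ae_iff, Measure.restrict_apply (measurableSet_singleton x).compl] at hx
  have : η.toMeasure C ≤ η.toMeasure {x} + η.toMeasure ({x}ᶜ ∩ C) :=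
    (measure_mono fun y hy => by
      by_cases hyx : y = x
      · exact Or.inl hyx
      · exact Or.inr ⟨hyx, hy⟩).trans (measure_union_le _ _)
  rw [h0, hx', hCn] at this
  simpa using this

theorem measurable_mass [StandardBorelSpace E] :
    Measurable fun q : Config E × E => q.1.toMeasure {q.2} := by
  have hd : MeasurableSet {r : (Config E × E) × E | r.2 = r.1.2} :=
    measurableSet_eq_fun measurable_snd (measurable_snd.comp measurable_fst)
  exact Kernel.measurable_kernel_prodMk_left (κ := Kernel.prodMkRight E (kernel E)) hd

theorem ae_mass_ne_zero [StandardBorelSpace E] (η : Config E) :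
    ∀ᵐ x ∂η.toMeasure, η.toMeasure {x} ≠ 0 := by
  have hm : MeasurableSet {x | η.toMeasure {x} = 0} :=
    (measurable_mass.comp (measurable_prodMk_left (x := η))) (measurableSet_singleton 0)
  rw [ae_iff]
  by_contra h
  obtain ⟨x, hx, hx'⟩ := exists_atom η (B := {x | η.toMeasure {x} = 0}) hm (by simpa using h)
  exact hx' hx

theorem dirac_le {η : Config E} [MeasurableSingletonClass E] {x : E}
    (hx : η.toMeasure {x} ≠ 0) : Measure.dirac x ≤ η.toMeasure := by
  obtain ⟨n, hn⟩ := η.counting {x} (measurableSet_singleton x)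
  have h1 : 1 ≤ η.toMeasure {x} := by
    rw [hn] at hx ⊢
    exact_mod_cast Nat.one_le_iff_ne_zero.2 (by exact_mod_cast hx)
  refine Measure.le_iff.2 fun B hB => ?_
  rw [Measure.dirac_apply' x hB]
  by_cases hxB : x ∈ B
  · simpa [hxB] using h1.trans (measure_mono (Set.singleton_subset_iff.2 hxB))
  · simp [hxB]

/-- At an atom `x` of `η`, the configuration `η.remove x` is the measure `η - δ_x`. -/
theorem toMeasure_remove [MeasurableSingletonClass E] {η : Config E} {x : E}
    (hx : η.toMeasure {x} ≠ 0) : (η.remove x).toMeasure = η.toMeasure - Measure.dirac x := by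
  rw [remove, dif_pos]
  intro B hB
  obtain ⟨n, hn⟩ := η.counting B hB
  rw [Measure.sub_apply hB (dirac_le hx), hn, Measure.dirac_apply' x hB]
  by_cases hxB : x ∈ B
  · exact ⟨n - 1, by simp [hxB]⟩
  · exact ⟨n, by simp [hxB]⟩

theorem add_remove [MeasurableSingletonClass E] {η : Config E} {x : E}
    (hx : η.toMeasure {x} ≠ 0) : (η.remove x).add x = η := by
  ext1
  rw [toMeasure_add, toMeasure_remove hx, Measure.sub_add_cancel_of_le (dirac_le hx)]

open Classical in
theorem measurable_remove [StandardBorelSpace E] :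
    Measurable fun q : Config E × E =>
      if q.1.toMeasure {q.2} = 0 then (0 : Config E) else q.1.remove q.2 := by
  refine measurable_of_eval fun B hB => ?_
  have : (fun q : Config E × E =>
      (if q.1.toMeasure {q.2} = 0 then (0 : Config E) else q.1.remove q.2).toMeasure B) =
      fun q : Config E × E => if q.1.toMeasure {q.2} = 0 then 0 else
        q.1.toMeasure B - B.indicator 1 q.2 := by
    ext q
    split_ifs with h
    · simp
    · rw [toMeasure_remove h, Measure.sub_apply hB (dirac_le h), Measure.dirac_apply' _ hB]
  rw [this]
  refine Measurable.ite (measurable_mass (measurableSet_singleton 0)) measurable_const ?_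
  exact ((measurable_eval hB).comp measurable_fst).sub
    ((measurable_one.indicator hB).comp measurable_snd)

end Config

/-! ### The Pascal point process -/

/-- `ρ` is the law of the Pascal point process with parameters `p` and `α`: the number of points
in `B` has the negative binomial law
`ρ(η(B) = n) = (1 - p) ^ α(B) * p ^ n / n! * α(B) (α(B) + 1) ⋯ (α(B) + n - 1)`,
and the numbers of points in finitely many pairwise disjoint sets are independent. -/
structure IsPascalLaw (p : ℝ) (α : Measure E) (ρ : Measure (Config E)) : Prop where
  isProbabilityMeasure : IsProbabilityMeasure ρ
  count : ∀ B : Set E, MeasurableSet B → ∀ n : ℕ,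
    ρ {η | η.toMeasure B = n} = ENNReal.ofReal
      ((1 - p) ^ (α.real B) * (p ^ n / n.factorial) * (ascPochhammer ℝ n).eval (α.real B))
  indep : ∀ n : ℕ, 2 ≤ n → ∀ B : Fin n → Set E, (∀ i, MeasurableSet (B i)) →
    Pairwise (Function.onFun Disjoint B) →
    iIndepFun (fun i (η : Config E) => η.toMeasure (B i)) ρ

/-- The transition kernel that adds to `η` a point with law proportional to `α + η`
(without normalisation). -/
def urnKernel (α : Measure E) [IsFiniteMeasure α] : Kernel (Config E) (Config E) :=
  (Kernel.id ×ₖ (Kernel.const _ α + Config.kernel E)).map fun q => q.1.add q.2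

/-- The unnormalised law of `n` points added one after the other to the empty configuration. -/
def urn (α : Measure E) [IsFiniteMeasure α] : ℕ → Measure (Config E)
  | 0 => Measure.dirac 0
  | n + 1 => (urn α n).bind (urnKernel α)

section Mecke

variable (α : Measure E) [IsFiniteMeasure α]

theorem measurable_lintegral_kernel {f : Config E × E → ℝ≥0∞} (hf : Measurable f) :
    Measurable fun η : Config E => ∫⁻ x, f (η, x) ∂η.toMeasure :=
  hf.lintegral_kernel_prod_right' (κ := Config.kernel E)

theorem measurable_lintegral_add {f : Config E × E → ℝ≥0∞} (hf : Measurable f) :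
    Measurable fun η : Config E => ∫⁻ x, f (η, x) ∂(α + η.toMeasure) :=
  hf.lintegral_kernel_prod_right' (κ := Kernel.const _ α + Config.kernel E)

theorem lintegral_urn_succ (n : ℕ) {G : Config E → ℝ≥0∞} (hG : Measurable G) :
    ∫⁻ η, G η ∂urn α (n + 1) = ∫⁻ η, ∫⁻ x, G (η.add x) ∂(α + η.toMeasure) ∂urn α n := by
  rw [urn, Measure.lintegral_bind (Kernel.aemeasurable _) hG.aemeasurable]
  refine lintegral_congr fun η => ?_
  rw [urnKernel, Kernel.lintegral_map _ Config.measurable_add _ hG,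
    Kernel.lintegral_id_prod (f := fun q : Config E × E => G (q.1.add q.2)) (hG.comp Config.measurable_add)]
  simp

theorem swap_aux (μ : Measure E) [IsFiniteMeasure μ] {f : E × E → ℝ≥0∞} (hf : Measurable f) :
    ∫⁻ x, ∫⁻ y, f (x, y) ∂(μ + Measure.dirac x) ∂μ =
      ∫⁻ y, ∫⁻ x, f (x, y) ∂(μ + Measure.dirac y) ∂μ := by
  have h1 : ∀ x, ∫⁻ y, f (x, y) ∂(μ + Measure.dirac x) = ∫⁻ y, f (x, y) ∂μ + f (x, x) := by
    intro x
    rw [lintegral_add_measure,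
      lintegral_dirac' x (f := fun y => f (x, y)) (hf.comp measurable_prodMk_left)]
  have h2 : ∀ y, ∫⁻ x, f (x, y) ∂(μ + Measure.dirac y) = ∫⁻ x, f (x, y) ∂μ + f (y, y) := by
    intro x
    rw [lintegral_add_measure,
      lintegral_dirac' x (f := fun y => f (y, x)) (hf.comp measurable_prodMk_right)]
  simp_rw [h1, h2]
  rw [lintegral_add_left hf.lintegral_prod_right', lintegral_add_left hf.lintegral_prod_left',
    lintegral_lintegral_swap (f := fun x y => f (x, y)) hf.aemeasurable]

theorem Config.add_comm (η : Config E) (x y : E) : (η.add x).add y = (η.add y).add x := by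
  ext1; simp [add_assoc, _root_.add_comm (Measure.dirac x)]

theorem mecke_urn (n : ℕ) {F : Config E × E → ℝ≥0∞} (hF : Measurable F) :
    ∫⁻ η, ∫⁻ x, F (η, x) ∂η.toMeasure ∂urn α (n + 1) =
      (n + 1) * ∫⁻ η, ∫⁻ x, F (η.add x, x) ∂(α + η.toMeasure) ∂urn α n := by
  have hF1 : Measurable fun q : Config E × E => F (q.1.add q.2, q.2) :=
    hF.comp (Config.measurable_add.prodMk measurable_snd)
  induction n generalizing F with
  | zero =>
    rw [lintegral_urn_succ α 0 (measurable_lintegral_kernel hF)]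
    simp only [urn, CharP.cast_eq_zero, zero_add, one_mul]
    rw [lintegral_dirac' _ (measurable_lintegral_add α hF1), lintegral_dirac']
    · refine lintegral_congr fun x => ?_
      simp only [Config.toMeasure_add, Config.toMeasure_zero, zero_add]
      rw [lintegral_dirac' x (f := fun y => F (Config.add 0 x, y)) (hF.comp measurable_prodMk_left)]
    · exact measurable_lintegral_add α
        (f := fun q => ∫⁻ x, F (q.1.add q.2, x) ∂(q.1.add q.2).toMeasure)
        ((measurable_lintegral_kernel hF).comp Config.measurable_add)
  | succ n ih =>
    have hF2 : Measurable fun r : (Config E × E) × E => F (r.1.1.add r.2, r.1.2) :=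
      hF.comp ((Config.measurable_add.comp
        ((measurable_fst.comp measurable_fst).prodMk measurable_snd)).prodMk
        (measurable_snd.comp measurable_fst))
    have hF' : Measurable fun q : Config E × E =>
        ∫⁻ y, F (q.1.add y, q.2) ∂(α + q.1.toMeasure) :=
      hF2.lintegral_kernel_prod_right'
        (κ := Kernel.prodMkRight E (Kernel.const (Config E) α + Config.kernel E))
    have hin : ∀ η : Config E, Measurable fun q : E × E => F (η.add q.1, q.2) := fun η =>
      hF.comp ((Config.measurable_add.comp (measurable_const.prodMk measurable_fst)).prodMk
        measurable_snd)
    rw [lintegral_urn_succ α (n + 1) (measurable_lintegral_kernel hF)]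
    have h1 : ∀ η : Config E,
        ∫⁻ y, ∫⁻ x, F (η.add y, x) ∂(η.add y).toMeasure ∂(α + η.toMeasure) =
        ∫⁻ y, F (η.add y, y) ∂(α + η.toMeasure) +
          ∫⁻ x, ∫⁻ y, F (η.add y, x) ∂(α + η.toMeasure) ∂η.toMeasure := by
      intro η
      have hd : Measurable fun y => F (η.add y, y) := hF1.comp measurable_prodMk_left
      rw [lintegral_lintegral_swap (f := fun x y => F (η.add y, x))
        ((hin η).comp measurable_swap).aemeasurable, ← lintegral_add_left hd]
      refine lintegral_congr fun y => ?_
      rw [Config.toMeasure_add, lintegral_add_measure, _root_.add_comm,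
        lintegral_dirac' y (f := fun x => F (η.add y, x)) (hF.comp measurable_prodMk_left)]
    have hF1' : Measurable fun q : Config E × E =>
        ∫⁻ y, F ((q.1.add q.2).add y, q.2) ∂(α + (q.1.add q.2).toMeasure) :=
      hF'.comp (Config.measurable_add.prodMk measurable_snd)
    simp_rw [h1]
    rw [lintegral_add_left (measurable_lintegral_add α hF1), ih hF' hF1',
      lintegral_urn_succ α n (measurable_lintegral_add α hF1)]
    have h2 : ∀ η : Config E,
        ∫⁻ x, ∫⁻ y, F ((η.add x).add y, x) ∂(α + (η.add x).toMeasure) ∂(α + η.toMeasure) =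
        ∫⁻ y, ∫⁻ x, F ((η.add y).add x, x) ∂(α + (η.add y).toMeasure) ∂(α + η.toMeasure) := by
      intro η
      have := swap_aux (α + η.toMeasure) (f := fun q => F ((η.add q.1).add q.2, q.1))
        (hF.comp ((Config.measurable_add.comp ((Config.measurable_add.comp
          (measurable_const.prodMk measurable_fst)).prodMk measurable_snd)).prodMk measurable_fst))
      simp only [Config.toMeasure_add, ← add_assoc]
      rw [this]
      simp only [Config.add_comm]
    simp_rw [h2]
    push_cast
    ring

/-- The Pascal law, as a mixture of the laws `urn α n`. -/
def pascalMix (p : ℝ) : Measure (Config E) :=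
  Measure.sum fun n =>
    ENNReal.ofReal ((1 - p) ^ (α.real Set.univ) * (p ^ n / n.factorial)) • urn α n

theorem mecke_pascalMix {p : ℝ} (hp : p ∈ Set.Ioo (0 : ℝ) 1) {F : Config E × E → ℝ≥0∞}
    (hF : Measurable F) :
    ∫⁻ η, ∫⁻ x, F (η, x) ∂η.toMeasure ∂pascalMix α p =
      ENNReal.ofReal p * ∫⁻ η, ∫⁻ x, F (η.add x, x) ∂(α + η.toMeasure) ∂pascalMix α p := by
  simp only [pascalMix, lintegral_sum_measure, lintegral_smul_measure]
  rw [tsum_eq_zero_add' ENNReal.summable, ← ENNReal.tsum_mul_left]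
  have h0 : ∫⁻ η, ∫⁻ x, F (η, x) ∂η.toMeasure ∂urn α 0 = 0 := by
    rw [urn, lintegral_dirac' _ (measurable_lintegral_kernel hF)]
    simp
  rw [h0, smul_zero, zero_add]
  refine tsum_congr fun n => ?_
  rw [mecke_urn α n hF, smul_eq_mul, smul_eq_mul, ← mul_assoc, ← mul_assoc]
  congr 1
  have h1 : ((n : ℝ≥0∞) + 1) = ENNReal.ofReal ((n : ℝ) + 1) := by
    rw [ENNReal.ofReal_add (by positivity) zero_le_one]; simp
  have h2 : (0 : ℝ) < 1 - p := by linarith [hp.2]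
  have h3 := hp.1
  rw [h1, ← ENNReal.ofReal_mul (by positivity), ← ENNReal.ofReal_mul (by positivity)]
  congr 1
  rw [Nat.factorial_succ, pow_succ]
  push_cast
  field_simp

end Mecke

/-- The Mecke (Papangelou) equation that characterises the Pascal law. -/
def IsMecke (p : ℝ) (α : Measure E) (ρ : Measure (Config E)) : Prop :=
  ∀ F : Config E × E → ℝ≥0∞, Measurable F →
    ∫⁻ η, ∫⁻ x, F (η, x) ∂η.toMeasure ∂ρ =
      ENNReal.ofReal p * ∫⁻ η, ∫⁻ x, F (η.add x, x) ∂(α + η.toMeasure) ∂ρ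

open Classical in
theorem Config.cnt_add {B : Set E} (hB : MeasurableSet B) (η : Config E) (x : E) :
    Config.cnt B (η.add x) = Config.cnt B η + if x ∈ B then 1 else 0 := by
  rw [Config.cnt_eq_iff hB]
  push_cast
  rw [Config.cast_cnt hB, Config.toMeasure_add, Measure.add_apply, Measure.dirac_apply' _ hB]
  by_cases h : x ∈ B <;> simp [h]

/-- The weights of the negative binomial law, without normalisation. -/
def nbWeight (p a : ℝ) (n : ℕ) : ℝ := p ^ n / n.factorial * (ascPochhammer ℝ n).eval a

theorem ascPochhammer_nonneg {a : ℝ} (ha : 0 ≤ a) (n : ℕ) :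
    0 ≤ (ascPochhammer ℝ n).eval a := by
  induction n with
  | zero => simp
  | succ n ih => rw [ascPochhammer_succ_eval]; positivity

theorem nbWeight_nonneg {p a : ℝ} (hp : 0 ≤ p) (ha : 0 ≤ a) (n : ℕ) : 0 ≤ nbWeight p a n := by
  have := ascPochhammer_nonneg ha n
  unfold nbWeight; positivity

theorem nbWeight_succ (p a : ℝ) (n : ℕ) :
    (n + 1) * nbWeight p a (n + 1) = p * (a + n) * nbWeight p a n := by
  unfold nbWeight
  rw [ascPochhammer_succ_eval, Nat.factorial_succ, pow_succ]
  push_cast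
  field_simp

theorem hasSum_nbWeight {p a : ℝ} (hp : p ∈ Set.Ioo (0 : ℝ) 1) :
    HasSum (nbWeight p a) ((1 - p) ^ (-a)) := by
  have h := (Real.one_div_one_sub_rpow_hasFPowerSeriesOnBall_zero a).hasSum
    (y := p) (by
      rw [Metric.mem_eball, edist_zero_right, Real.enorm_eq_ofReal hp.1.le]
      simpa using hp.2)
  simp only [zero_add] at h
  rw [Real.rpow_neg (by linarith [hp.2]), ← one_div]
  have e : nbWeight p a = fun n : ℕ =>
      (FormalMultilinearSeries.ofScalars ℝ (fun n => Ring.choose (a + n - 1) n) n)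
        fun _ => p := by
    funext n
    have h1 := Ring.factorial_nsmul_multichoose_eq_ascPochhammer a n
    have h2 : Ring.choose (a + n - 1) n = Ring.multichoose a n := by
      rw [Ring.choose]; congr 1; ring
    have h3 : (n.factorial : ℝ) ≠ 0 := by positivity
    rw [FormalMultilinearSeries.ofScalars_apply_eq, h2, nbWeight,
      ← Polynomial.ascPochhammer_smeval_eq_eval, ← h1]
    simp only [nsmul_eq_mul, smul_eq_mul]
    field_simp
  rw [e]
  exact h

section Joint

variable {p : ℝ} {α : Measure E} {ρ : Measure (Config E)}
  {ι : Type*} [Fintype ι] {B : ι → Set E}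

theorem measurableSet_joint (hB : ∀ i, MeasurableSet (B i)) (m : ι → ℕ) :
    MeasurableSet {η : Config E | ∀ i, Config.cnt (B i) η = m i} := by
  rw [Set.ofPred_forall]
  exact MeasurableSet.iInter fun i => Config.measurable_cnt (hB i) (measurableSet_singleton _)

theorem joint_succ [DecidableEq ι] (hM : IsMecke p α ρ)
    (hB : ∀ i, MeasurableSet (B i))
    (hd : Pairwise (Function.onFun Disjoint B)) (m : ι → ℕ) (i : ι) :
    ρ {η | ∀ j, Config.cnt (B j) η = Function.update m i (m i + 1) j} * ((m i : ℝ≥0∞) + 1) =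
      ENNReal.ofReal p * (α (B i) + m i) * ρ {η | ∀ j, Config.cnt (B j) η = m j} := by
  classical
  set S' := {η : Config E | ∀ j, Config.cnt (B j) η = Function.update m i (m i + 1) j} with hS'
  set S := {η : Config E | ∀ j, Config.cnt (B j) η = m j} with hS
  have mS' : MeasurableSet S' := measurableSet_joint hB _
  have mS : MeasurableSet S := measurableSet_joint hB _
  have hiff : ∀ η : Config E, ∀ x ∈ B i, (η.add x ∈ S' ↔ η ∈ S) := by
    intro η x hx
    simp only [hS', hS, Set.mem_ofPred_eq]
    refine forall_congr' fun j => ?_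
    rw [Config.cnt_add (hB j)]
    by_cases hj : j = i
    · subst hj; simp [hx]
    · have : x ∉ B j := fun hxj => Set.disjoint_left.1 (hd hj) hxj hx
      simp [hj, this]
  have key := hM ((S' ×ˢ B i).indicator 1) (measurable_one.indicator (mS'.prod (hB i)))
  have e1 : ∀ η : Config E, ∫⁻ x, (S' ×ˢ B i).indicator (1 : Config E × E → ℝ≥0∞) (η, x) ∂η.toMeasure =
      S'.indicator (fun _ => (m i : ℝ≥0∞) + 1) η := by
    intro η
    by_cases hη : η ∈ S'
    · have h1 : η.toMeasure (B i) = (m i : ℝ≥0∞) + 1 := by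
        have := hη i
        rw [Function.update_self, Config.cnt_eq_iff (hB i)] at this
        rw [this]; push_cast; rfl
      have h2 : ∀ x, (S' ×ˢ B i).indicator (1 : Config E × E → ℝ≥0∞) (η, x) = (B i).indicator 1 x := by
        intro x
        by_cases hx : x ∈ B i <;> simp [Set.indicator, hη, hx]
      simp_rw [h2]
      rw [lintegral_indicator_one (hB i), h1, Set.indicator_of_mem hη]
    · simp [Set.indicator, hη]
  have e2 : ∀ η : Config E,
      ∫⁻ x, (S' ×ˢ B i).indicator (1 : Config E × E → ℝ≥0∞) (η.add x, x) ∂(α + η.toMeasure) =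
      S.indicator (fun _ => α (B i) + m i) η := by
    intro η
    have h2 : ∀ x, (S' ×ˢ B i).indicator (1 : Config E × E → ℝ≥0∞) (η.add x, x) =
        if η ∈ S then (B i).indicator 1 x else 0 := by
      intro x
      by_cases hx : x ∈ B i <;> by_cases hη : η ∈ S <;> simp [Set.indicator, hη, hx, hiff]
    simp_rw [h2]
    by_cases hη : η ∈ S
    · simp only [hη, if_true]
      have := hη i
      rw [Config.cnt_eq_iff (hB i)] at this
      rw [lintegral_indicator_one (hB i), Set.indicator_of_mem hη, Measure.add_apply, this]
    · simp [hη]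
  simp_rw [e1, e2] at key
  rw [lintegral_indicator_const mS', lintegral_indicator_const mS] at key
  rw [mul_comm, key, mul_assoc]

theorem joint_update [DecidableEq ι] [IsFiniteMeasure α] (hp : p ∈ Set.Ioo (0 : ℝ) 1) (hM : IsMecke p α ρ)
    (hB : ∀ i, MeasurableSet (B i))
    (hd : Pairwise (Function.onFun Disjoint B)) (m : ι → ℕ) (i : ι) (k : ℕ) :
    ρ {η | ∀ j, Config.cnt (B j) η = Function.update m i k j} =
      ENNReal.ofReal (nbWeight p (α.real (B i)) k) *
        ρ {η | ∀ j, Config.cnt (B j) η = Function.update m i 0 j} := by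
  induction k with
  | zero => simp [nbWeight]
  | succ k ih =>
    have h := joint_succ hM hB hd (Function.update m i k) i
    simp only [Function.update_idem, Function.update_self] at h
    rw [ih] at h
    have hk : (k : ℝ≥0∞) + 1 = ENNReal.ofReal ((k : ℝ) + 1) := by
      rw [ENNReal.ofReal_add (by positivity) zero_le_one]; simp
    have hα : α (B i) + k = ENNReal.ofReal (α.real (B i) + k) := by
      rw [ENNReal.ofReal_add measureReal_nonneg (by positivity)]; simp
    have hk0 : (k : ℝ≥0∞) + 1 ≠ 0 := by simp
    have hkt : (k : ℝ≥0∞) + 1 ≠ ∞ := by finiteness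
    rw [← ENNReal.mul_left_inj hk0 hkt, h, mul_right_comm _ _ ((k : ℝ≥0∞) + 1), hk, hα,
      ← mul_assoc, ← ENNReal.ofReal_mul hp.1.le,
      ← ENNReal.ofReal_mul (mul_nonneg hp.1.le (by positivity)),
      ← ENNReal.ofReal_mul (nbWeight_nonneg hp.1.le measureReal_nonneg _),
      ← nbWeight_succ, mul_comm ((k : ℝ) + 1)]

theorem joint_eq [DecidableEq ι] [IsFiniteMeasure α] (hp : p ∈ Set.Ioo (0 : ℝ) 1) (hM : IsMecke p α ρ)
    (hB : ∀ i, MeasurableSet (B i))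
    (hd : Pairwise (Function.onFun Disjoint B)) (m : ι → ℕ) :
    ρ {η | ∀ j, Config.cnt (B j) η = m j} =
      (∏ i, ENNReal.ofReal (nbWeight p (α.real (B i)) (m i))) *
        ρ {η | ∀ j, Config.cnt (B j) η = 0} := by
  have : ∀ s : Finset ι, ρ {η | ∀ j, Config.cnt (B j) η = m j} =
      (∏ i ∈ s, ENNReal.ofReal (nbWeight p (α.real (B i)) (m i))) *
        ρ {η | ∀ j, Config.cnt (B j) η = if j ∈ s then 0 else m j} := by
    intro s
    induction s using Finset.induction_on with
    | empty => simp
    | insert i s his ih =>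
      rw [ih, Finset.prod_insert his]
      have h := joint_update hp hM hB hd (fun j => if j ∈ s then 0 else m j) i (m i)
      have e1 : Function.update (fun j => if j ∈ s then 0 else m j) i (m i) =
          fun j => if j ∈ s then 0 else m j := by
        ext j; by_cases hj : j = i
        · subst hj; simp [his]
        · simp [hj]
      have e2 : Function.update (fun j => if j ∈ s then 0 else m j) i 0 =
          fun j => if j ∈ insert i s then 0 else m j := by
        ext j; by_cases hj : j = i
        · subst hj; simp
        · simp [hj]
      rw [e1, e2] at h
      rw [h]
      ring
  simpa using this Finset.univ

theorem single_eq [IsFiniteMeasure α] (hp : p ∈ Set.Ioo (0 : ℝ) 1) (hM : IsMecke p α ρ) {U : Set E} (hU : MeasurableSet U) (n : ℕ) :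
    ρ {η | Config.cnt U η = n} =
      ENNReal.ofReal (nbWeight p (α.real U) n) * ρ {η | Config.cnt U η = 0} := by
  simpa using joint_eq hp hM (ι := Unit) (B := fun _ => U) (fun _ => hU)
    (fun i j h => (h rfl).elim) (fun _ => n)

theorem total_eq [IsFiniteMeasure α] (hp : p ∈ Set.Ioo (0 : ℝ) 1) (hM : IsMecke p α ρ) {U : Set E} (hU : MeasurableSet U) :
    ρ Set.univ = ENNReal.ofReal ((1 - p) ^ (-α.real U)) * ρ {η | Config.cnt U η = 0} := by
  have hun : (Set.univ : Set (Config E)) = ⋃ n : ℕ, {η | Config.cnt U η = n} := by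
    ext η; simp
  rw [hun, measure_iUnion]
  · rw [tsum_congr (single_eq hp hM hU), ENNReal.tsum_mul_right, ← (hasSum_nbWeight hp).tsum_eq,
      ENNReal.ofReal_tsum_of_nonneg
      (nbWeight_nonneg hp.1.le measureReal_nonneg) (hasSum_nbWeight hp).summable]
  · intro i j hij
    refine Set.disjoint_left.2 fun η h1 h2 => hij ?_
    simp only [Set.mem_ofPred_eq] at h1 h2
    omega
  · exact fun n => Config.measurable_cnt hU (measurableSet_singleton n)

theorem zero_eq [IsFiniteMeasure α] (hp : p ∈ Set.Ioo (0 : ℝ) 1) (hM : IsMecke p α ρ) [IsProbabilityMeasure ρ] {U : Set E} (hU : MeasurableSet U) :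
    ρ {η | Config.cnt U η = 0} = ENNReal.ofReal ((1 - p) ^ (α.real U)) := by
  have h := total_eq hp hM hU
  have h1 : (0 : ℝ) < 1 - p := by linarith [hp.2]
  rw [measure_univ] at h
  calc ρ {η | Config.cnt U η = 0} = ENNReal.ofReal ((1 - p) ^ (α.real U)) *
        (ENNReal.ofReal ((1 - p) ^ (-α.real U)) * ρ {η | Config.cnt U η = 0}) := by
        rw [← mul_assoc, ← ENNReal.ofReal_mul (by positivity), ← Real.rpow_add h1]
        simp
    _ = _ := by rw [← h, mul_one]

theorem joint_eq_prod [IsFiniteMeasure α] (hp : p ∈ Set.Ioo (0 : ℝ) 1) (hM : IsMecke p α ρ)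
    (hB : ∀ i, MeasurableSet (B i))
    (hd : Pairwise (Function.onFun Disjoint B)) [IsProbabilityMeasure ρ] (m : ι → ℕ) :
    ρ {η | ∀ j, Config.cnt (B j) η = m j} = ∏ i, ρ {η | Config.cnt (B i) η = m i} := by
  have h1 : (0 : ℝ) < 1 - p := by linarith [hp.2]
  have hU : MeasurableSet (⋃ i, B i) := MeasurableSet.iUnion hB
  have h0 : {η : Config E | ∀ j, Config.cnt (B j) η = 0} =
      {η | Config.cnt (⋃ i, B i) η = 0} := by
    ext η
    simp only [Set.mem_ofPred_eq, Config.cnt_eq_iff hU, Config.cnt_eq_iff (hB _)]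
    simp
  classical
  rw [joint_eq hp hM hB hd, h0, zero_eq hp hM hU]
  simp_rw [fun i => single_eq hp hM (hB i) (m i), fun i => zero_eq hp hM (hB i)]
  rw [Finset.prod_mul_distrib]
  congr 1
  rw [← ENNReal.ofReal_prod_of_nonneg (fun i _ => by positivity),
    ← Real.rpow_sum_of_pos h1, measureReal_iUnion_fintype hd hB]

theorem IsMecke.isPascalLaw [IsFiniteMeasure α] (hp : p ∈ Set.Ioo (0 : ℝ) 1) (hM : IsMecke p α ρ) [IsProbabilityMeasure ρ] : IsPascalLaw p α ρ where
  isProbabilityMeasure := inferInstance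
  count := by
    intro B hB n
    have h1 : (0 : ℝ) < 1 - p := by linarith [hp.2]
    simp_rw [← Config.cnt_eq_iff hB]
    rw [single_eq hp hM hB, zero_eq hp hM hB,
      ← ENNReal.ofReal_mul (nbWeight_nonneg hp.1.le measureReal_nonneg _), nbWeight]
    congr 1
    ring
  indep := by
    intro n _ B hB hd
    have h : iIndepFun (fun i (η : Config E) => Config.cnt (B i) η) ρ := by
      rw [iIndepFun_iff_map_fun_eq_pi_map
        (fun i => (Config.measurable_cnt (hB i)).aemeasurable)]
      have : ∀ i, IsProbabilityMeasure (ρ.map (Config.cnt (B i))) := fun i =>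
        Measure.isProbabilityMeasure_map (Config.measurable_cnt (hB i)).aemeasurable
      refine Measure.ext_of_singleton fun m => ?_
      rw [Measure.map_apply (measurable_pi_lambda _ fun i => Config.measurable_cnt (hB i))
        (measurableSet_singleton m), Measure.pi_singleton]
      have h1 : (fun (η : Config E) i => Config.cnt (B i) η) ⁻¹' {m} =
          {η | ∀ j, Config.cnt (B j) η = m j} := by
        ext η; simp [funext_iff]
      rw [h1, joint_eq_prod hp hM hB hd]
      refine Finset.prod_congr rfl fun i _ => ?_
      rw [Measure.map_apply (Config.measurable_cnt (hB i)) (measurableSet_singleton _)]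
      rfl
    have h2 := h.comp (fun _ (n : ℕ) => (n : ℝ≥0∞)) (fun _ => measurable_from_nat)
    convert h2 using 2 with i
    ext η
    exact (Config.cast_cnt (hB i) η).symm

end Joint

theorem pascalMix_isPascalLaw {p : ℝ} (hp : p ∈ Set.Ioo (0 : ℝ) 1) (α : Measure E)
    [IsFiniteMeasure α] : IsPascalLaw p α (pascalMix α p) := by
  have hM : IsMecke p α (pascalMix α p) := fun F hF => mecke_pascalMix α hp hF
  have h1 : (0 : ℝ) < 1 - p := by linarith [hp.2]
  have hm : MeasurableSet {η : Config E | Config.cnt Set.univ η = 0} :=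
    Config.measurable_cnt MeasurableSet.univ (measurableSet_singleton 0)
  have h0 : pascalMix α p {η | Config.cnt Set.univ η = 0} =
      ENNReal.ofReal ((1 - p) ^ (α.real Set.univ)) := by
    rw [pascalMix, Measure.sum_apply _ hm, tsum_eq_single 0]
    · have : (0 : Config E) ∈ {η : Config E | Config.cnt Set.univ η = 0} := by
        simp [Config.cnt]
      simp [urn, Measure.dirac_apply' _ hm, this]
    · intro n hn
      obtain ⟨k, rfl⟩ := Nat.exists_eq_succ_of_ne_zero hn
      have : urn α (k + 1) {η | Config.cnt Set.univ η = 0} = 0 := by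
        rw [← lintegral_indicator_one hm, lintegral_urn_succ α k (measurable_one.indicator hm)]
        simp [Set.indicator, Config.cnt_add MeasurableSet.univ]
      simp [this]
  have : IsProbabilityMeasure (pascalMix α p) := ⟨by
    rw [total_eq hp hM MeasurableSet.univ, h0, ← ENNReal.ofReal_mul (by positivity),
      ← Real.rpow_add h1]
    simp⟩
  exact hM.isPascalLaw hp


section Unique

variable {p : ℝ} {α : Measure E} {ρ ρ' : Measure (Config E)}

theorem IsPascalLaw.map_cnt_eq (h : IsPascalLaw p α ρ) (h' : IsPascalLaw p α ρ') {B : Set E}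
    (hB : MeasurableSet B) : ρ.map (Config.cnt B) = ρ'.map (Config.cnt B) := by
  refine Measure.ext_of_singleton fun n => ?_
  rw [Measure.map_apply (Config.measurable_cnt hB) (measurableSet_singleton n),
    Measure.map_apply (Config.measurable_cnt hB) (measurableSet_singleton n)]
  have : Config.cnt B ⁻¹' {n} = {η : Config E | η.toMeasure B = n} := by
    ext η; simp [Config.cnt_eq_iff hB]
  rw [this, h.count B hB, h'.count B hB]

theorem IsPascalLaw.map_eq_pi (h : IsPascalLaw p α ρ) {n : ℕ} {B : Fin n → Set E}
    (hn : 2 ≤ n) (hB : ∀ i, MeasurableSet (B i)) (hd : Pairwise (Function.onFun Disjoint B)) :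
    ρ.map (fun η i => Config.cnt (B i) η) = Measure.pi fun i => ρ.map (Config.cnt (B i)) := by
  have := h.isProbabilityMeasure
  have h1 := (h.indep n hn B hB hd).comp (fun _ (c : ℝ≥0∞) => ⌊c.toReal⌋₊)
    (fun _ => Nat.measurable_floor.comp ENNReal.measurable_toReal)
  exact (iIndepFun_iff_map_fun_eq_pi_map
    (fun i => (Config.measurable_cnt (hB i)).aemeasurable)).1 h1

theorem IsPascalLaw.map_joint_eq (h : IsPascalLaw p α ρ) (h' : IsPascalLaw p α ρ')
    {ι : Type*} [Finite ι] {B : ι → Set E} (hB : ∀ i, MeasurableSet (B i))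
    (hd : Pairwise (Function.onFun Disjoint B)) :
    ρ.map (fun η i => Config.cnt (B i) η) = ρ'.map (fun η i => Config.cnt (B i) η) := by
  have := h.isProbabilityMeasure
  have := h'.isProbabilityMeasure
  obtain ⟨n, ⟨e⟩⟩ := Finite.exists_equiv_fin ι
  -- pad with two empty sets, so that there are at least two sets
  let C : Fin (n + 2) → Set E := fun i => if hi : (i : ℕ) < n then B (e.symm ⟨i, hi⟩) else ∅
  have hC : ∀ i, MeasurableSet (C i) := by
    intro i; simp only [C]; split_ifs
    · exact hB _
    · exact MeasurableSet.empty
  have hCd : Pairwise (Function.onFun Disjoint C) := by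
    intro i j hij
    simp only [Function.onFun, C]
    split_ifs with h1 h2
    · refine hd fun heq => hij ?_
      have := e.symm.injective heq
      exact Fin.ext (by simpa using this)
    all_goals simp
  have hpi : ρ.map (fun η i => Config.cnt (C i) η) = ρ'.map (fun η i => Config.cnt (C i) η) := by
    rw [h.map_eq_pi (by omega) hC hCd, h'.map_eq_pi (by omega) hC hCd]
    congr 1
    funext i
    exact h.map_cnt_eq h' (hC i)
  have hm : Measurable fun (η : Config E) i => Config.cnt (C i) η :=
    measurable_pi_lambda _ fun i => Config.measurable_cnt (hC i)
  let g : (Fin (n + 2) → ℕ) → ι → ℕ := fun c i => c ⟨e i, by omega⟩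
  have hg : Measurable g := measurable_pi_lambda _ fun i => measurable_pi_apply _
  have hcomp : (fun (η : Config E) i => Config.cnt (B i) η) =
      g ∘ fun (η : Config E) i => Config.cnt (C i) η := by
    funext η i
    simp [g, C]
  rw [hcomp, ← Measure.map_map hg hm, hpi, Measure.map_map hg hm]

theorem IsPascalLaw.unique (h : IsPascalLaw p α ρ) (h' : IsPascalLaw p α ρ') : ρ = ρ' := by
  classical
  have := h.isProbabilityMeasure
  have := h'.isProbabilityMeasure
  let m : {B : Set E // MeasurableSet B} → MeasurableSpace (Config E) := fun B =>
    MeasurableSpace.comap (fun η : Config E => η.toMeasure B) inferInstance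
  refine ext_of_generate_finite
    (piiUnionInter (fun B => {s | MeasurableSet[m B] s}) Set.univ)
    ?_ (isPiSystem_piiUnionInter _ (fun B => @MeasurableSpace.isPiSystem_measurableSet _ (m B)) _)
    ?_ (by simp)
  · rw [generateFrom_piiUnionInter_measurableSet m Set.univ]
    simp only [Set.mem_univ, iSup_pos]
    rfl
  rintro s ⟨t, -, f, hf, rfl⟩
  choose! S hS hSf using fun B (hB : B ∈ t) => hf B hB
  -- the atoms of the finite algebra generated by the sets in `t`
  let A : (t → Bool) → Set E := fun b => {x | ∀ B : t, (x ∈ B.1.1 ↔ b B = true)}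
  have hA : ∀ b, MeasurableSet (A b) := by
    intro b
    simp only [A, Set.ofPred_forall]
    refine MeasurableSet.iInter fun B => ?_
    by_cases hb : b B = true
    · simp only [hb, iff_true]; exact B.1.2
    · simp only [hb, Bool.false_eq_true, iff_false]; exact B.1.2.compl
  have hAd : Pairwise (Function.onFun Disjoint A) := by
    intro b c hbc
    refine Set.disjoint_left.2 fun x hx hx' => hbc ?_
    funext B
    have h1 := hx B
    have h2 := hx' B
    rw [h1] at h2
    exact Bool.eq_iff_iff.2 h2
  have hdec : ∀ (B : t) (η : Config E), η.toMeasure B.1.1 =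
      ∑ b : t → Bool, if b B = true then (Config.cnt (A b) η : ℝ≥0∞) else 0 := by
    intro B η
    have hBU : B.1.1 = ⋃ b ∈ Finset.univ.filter (fun b : t → Bool => b B = true), A b := by
      ext x
      simp only [Finset.mem_filter, Finset.mem_univ, true_and, Set.mem_iUnion, exists_prop]
      constructor
      · intro hx
        exact ⟨fun C => decide (x ∈ C.1.1), by simpa using hx, fun C => by simp⟩
      · rintro ⟨b, hb, hx⟩
        exact (hx B).2 hb
    conv_lhs => rw [hBU]
    rw [measure_biUnion_finset (fun b _ c _ hbc => hAd hbc) (fun b _ => hA b),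
      Finset.sum_filter]
    simp only [Config.cast_cnt (hA _)]
  have hset : (⋂ B ∈ t, f B) = (fun (η : Config E) b => Config.cnt (A b) η) ⁻¹'
      {c | ∀ B : t, (∑ b : t → Bool, if b B = true then (c b : ℝ≥0∞) else 0) ∈ S B.1} := by
    ext η
    simp only [Set.mem_iInter, Set.mem_preimage, Set.mem_ofPred_eq, ← hdec]
    constructor
    · intro hη B
      have := hη B.1 B.2
      rwa [← hSf B.1 B.2] at this
    · intro hη B hB
      rw [← hSf B hB]
      exact hη ⟨B, hB⟩
  have hmeas : Measurable fun (η : Config E) b => Config.cnt (A b) η :=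
    measurable_pi_lambda _ fun b => Config.measurable_cnt (hA b)
  rw [hset, ← Measure.map_apply hmeas (Set.to_countable _).measurableSet,
    ← Measure.map_apply hmeas (Set.to_countable _).measurableSet, h.map_joint_eq h' hA hAd]

end Unique

/-- Existence and uniqueness of the Pascal law. -/
theorem existsUnique_isPascalLaw (p : Set.Ioo (0 : ℝ) 1) (α : Measure E) [IsFiniteMeasure α] :
    ∃! ρ : Measure (Config E), IsPascalLaw p α ρ :=
  ⟨pascalMix α p, pascalMix_isPascalLaw p.2 α, fun _ h => h.unique (pascalMix_isPascalLaw p.2 α)⟩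

/-- The law `ρ_{p, α}` of the Pascal point process. -/
def pascalLaw (p : Set.Ioo (0 : ℝ) 1) (α : Measure E) [IsFiniteMeasure α] :
    Measure (Config E) :=
  (existsUnique_isPascalLaw p α).choose

theorem isPascalLaw_pascalLaw (p : Set.Ioo (0 : ℝ) 1) (α : Measure E) [IsFiniteMeasure α] :
    IsPascalLaw p α (pascalLaw p α) :=
  (existsUnique_isPascalLaw p α).choose_spec.1

instance (p : Set.Ioo (0 : ℝ) 1) (α : Measure E) [IsFiniteMeasure α] :
    IsProbabilityMeasure (pascalLaw p α) :=
  (isPascalLaw_pascalLaw p α).isProbabilityMeasure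

theorem isMecke_pascalLaw (p : Set.Ioo (0 : ℝ) 1) (α : Measure E) [IsFiniteMeasure α] :
    IsMecke p α (pascalLaw p α) := by
  rw [(isPascalLaw_pascalLaw p α).unique (pascalMix_isPascalLaw p.2 α)]
  exact fun F hF => mecke_pascalMix α p.2 hF

/-! ### Raising and lowering operators -/

/-- Bounded measurable functions `φ : E → ℂ`. -/
abbrev BddMeasurable (E : Type*) [MeasurableSpace E] : Type _ :=
  {φ : E → ℂ // Measurable φ ∧ ∃ C : ℝ, ∀ x, ‖φ x‖ ≤ C}

/-- The constant function `1` on `E`. -/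
def one (E : Type*) [MeasurableSpace E] : BddMeasurable E :=
  ⟨fun _ => 1, measurable_const, 1, fun _ => by simp⟩

/-- The bounded measurable functions `F` on configurations for which there is a cutoff `m` such
that `F` vanishes outside `{η | η(E) ≤ m}`. -/
def cutoffFun (E : Type*) [MeasurableSpace E] : Submodule ℂ (Config E → ℂ) where
  carrier := {F | Measurable F ∧ (∃ C : ℝ, ∀ η, ‖F η‖ ≤ C) ∧
    ∃ m : ℕ, ∀ η, F η ≠ 0 → η.toMeasure Set.univ ≤ m}
  zero_mem' := ⟨measurable_const, ⟨0, by simp⟩, 0, by simp⟩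
  add_mem' := by
    rintro F G ⟨hF, ⟨C, hC⟩, m, hm⟩ ⟨hG, ⟨D, hD⟩, n, hn⟩
    refine ⟨hF.add hG, ⟨C + D, fun η => (norm_add_le _ _).trans (add_le_add (hC η) (hD η))⟩,
      max m n, fun η hη => ?_⟩
    by_cases h : F η = 0
    · have hG0 : G η ≠ 0 := fun h' => hη (by simp [h, h'])
      exact (hn η hG0).trans (by exact_mod_cast le_max_right m n)
    · exact (hm η h).trans (by exact_mod_cast le_max_left m n)
  smul_mem' := by
    rintro c F ⟨hF, ⟨C, hC⟩, m, hm⟩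
    refine ⟨hF.const_smul c, ⟨‖c‖ * C, fun η => ?_⟩, m, fun η hη => hm η fun h => hη (by simp [h])⟩
    rw [Pi.smul_apply, norm_smul]
    exact mul_le_mul_of_nonneg_left (hC η) (norm_nonneg c)

/-- `k⁺(φ) F (η) = p^(-1/2) ∫ φ(x) F(η - δ_x) η(dx)`. -/
def raiseFun (p : ℝ) (φ : E → ℂ) (F : Config E → ℂ) (η : Config E) : ℂ :=
  (1 / Real.sqrt p : ℝ) * ∫ x, φ x * F (η.remove x) ∂η.toMeasure

/-- `k⁻(φ) F (η) = p^(1/2) ∫ conj φ(x) F(η + δ_x) (α + η)(dx)`. -/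
def lowerFun (p : ℝ) (α : Measure E) (φ : E → ℂ) (F : Config E → ℂ) (η : Config E) : ℂ :=
  (Real.sqrt p : ℝ) * ∫ x, conj (φ x) * F (η.add x) ∂(α + η.toMeasure)

section Operators

open Classical in
/-- A jointly measurable version of `η - δ_x`. -/
def removeAux (q : Config E × E) : Config E :=
  if q.1.toMeasure {q.2} = 0 then 0 else q.1.remove q.2

theorem measurable_removeAux [StandardBorelSpace E] :
    Measurable (removeAux : Config E × E → Config E) :=
  Config.measurable_remove

theorem removeAux_ae [StandardBorelSpace E] (η : Config E) :
    ∀ᵐ x ∂η.toMeasure, removeAux (η, x) = η.remove x ∧ (η.remove x).add x = η := by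
  filter_upwards [η.ae_mass_ne_zero] with x hx
  exact ⟨by simp [removeAux, hx], Config.add_remove hx⟩

theorem raise_integral_eq [StandardBorelSpace E] (φ : E → ℂ) (F : Config E → ℂ)
    (η : Config E) :
    ∫ x, φ x * F (η.remove x) ∂η.toMeasure = ∫ x, φ x * F (removeAux (η, x)) ∂η.toMeasure := by
  refine integral_congr_ae ?_
  filter_upwards [removeAux_ae η] with x hx
  rw [hx.1]

theorem integrable_raise [StandardBorelSpace E] (φ : BddMeasurable E)
    {F : Config E → ℂ} (hF : F ∈ cutoffFun E)
    (η : Config E) : Integrable (fun x => φ.1 x * F (η.remove x)) η.toMeasure := by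
  obtain ⟨hFm, ⟨C, hC⟩, -⟩ := hF
  obtain ⟨φ, hφm, D, hD⟩ := φ
  have h : Integrable (fun x => φ x * F (removeAux (η, x))) η.toMeasure := by
    refine Integrable.of_bound (C := D * C) ?_ (Filter.Eventually.of_forall fun x => ?_)
    · exact (hφm.mul (hFm.comp (measurable_removeAux.comp
        measurable_prodMk_left))).aestronglyMeasurable
    · rw [norm_mul]
      exact mul_le_mul (hD x) (hC _) (norm_nonneg _) ((norm_nonneg _).trans (hD x))
  refine h.congr ?_
  filter_upwards [removeAux_ae η] with x hx
  rw [hx.1]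

theorem integrable_lower (α : Measure E) [IsFiniteMeasure α] (φ : BddMeasurable E)
    {F : Config E → ℂ} (hF : F ∈ cutoffFun E) (η : Config E) :
    Integrable (fun x => conj (φ.1 x) * F (η.add x)) (α + η.toMeasure) := by
  obtain ⟨hFm, ⟨C, hC⟩, -⟩ := hF
  obtain ⟨φ, hφm, D, hD⟩ := φ
  refine Integrable.of_bound (C := D * C) ?_ (Filter.Eventually.of_forall fun x => ?_)
  · exact ((Complex.continuous_conj.measurable.comp hφm).mul (hFm.comp
      (Config.measurable_add.comp measurable_prodMk_left))).aestronglyMeasurable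
  · rw [norm_mul, RCLike.norm_conj]
    exact mul_le_mul (hD x) (hC _) (norm_nonneg _) ((norm_nonneg _).trans (hD x))

theorem raiseFun_mem [StandardBorelSpace E] (p : ℝ) (φ : BddMeasurable E)
    {F : Config E → ℂ} (hF : F ∈ cutoffFun E) :
    raiseFun p φ.1 F ∈ cutoffFun E := by
  obtain ⟨hFm, ⟨C, hC⟩, m, hm⟩ := hF
  obtain ⟨φ, hφm, D, hD⟩ := φ
  have hsupp : ∀ η, raiseFun p φ F η ≠ 0 → η.toMeasure Set.univ ≤ ((m + 1 : ℕ) : ℝ≥0∞) := by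
    intro η hη
    by_contra hcon
    refine hη ?_
    rw [raiseFun, integral_eq_zero_of_ae, mul_zero]
    filter_upwards [removeAux_ae η] with x hx
    by_cases h0 : F (η.remove x) = 0
    · simp [h0]
    · refine (hcon ?_).elim
      have h1 := hm _ h0
      rw [← hx.2, Config.toMeasure_add, Measure.add_apply]
      push_cast
      exact add_le_add h1 (by simp)
  refine ⟨?_, ⟨|1 / Real.sqrt p| * (|D| * |C| * (m + 1)), fun η => ?_⟩, m + 1, hsupp⟩
  · have h : StronglyMeasurable fun q : Config E × E => φ q.2 * F (removeAux q) :=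
      ((hφm.comp measurable_snd).mul (hFm.comp measurable_removeAux)).stronglyMeasurable
    have h2 := (h.integral_kernel_prod_right' (κ := Config.kernel E)).measurable
    have : raiseFun p φ F = fun η => ((1 / Real.sqrt p : ℝ) : ℂ) *
        ∫ x, φ x * F (removeAux (η, x)) ∂(Config.kernel E η) := by
      funext η
      rw [raiseFun, raise_integral_eq]; rfl
    rw [this]
    exact h2.const_mul _
  · by_cases h0 : raiseFun p φ F η = 0
    · rw [h0, norm_zero]; positivity
    have hmass : η.toMeasure.real Set.univ ≤ m + 1 := by
      have := ENNReal.toReal_mono (ENNReal.natCast_ne_top _) (hsupp η h0)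
      rw [ENNReal.toReal_natCast] at this
      exact_mod_cast this
    rw [raiseFun, norm_mul, Complex.norm_real, Real.norm_eq_abs]
    refine mul_le_mul_of_nonneg_left ?_ (abs_nonneg _)
    refine (norm_integral_le_of_norm_le_const (C := |D| * |C|)
      (Filter.Eventually.of_forall fun x => ?_)).trans
      (mul_le_mul_of_nonneg_left hmass (by positivity))
    rw [norm_mul]
    exact mul_le_mul ((hD x).trans (le_abs_self D)) ((hC _).trans (le_abs_self C))
      (norm_nonneg _) (abs_nonneg _)

theorem lowerFun_mem (p : ℝ) (α : Measure E) [IsFiniteMeasure α] (φ : BddMeasurable E)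
    {F : Config E → ℂ} (hF : F ∈ cutoffFun E) : lowerFun p α φ.1 F ∈ cutoffFun E := by
  obtain ⟨hFm, ⟨C, hC⟩, m, hm⟩ := hF
  obtain ⟨φ, hφm, D, hD⟩ := φ
  have hsupp : ∀ η, lowerFun p α φ F η ≠ 0 → η.toMeasure Set.univ ≤ (m : ℝ≥0∞) := by
    intro η hη
    by_contra hcon
    refine hη ?_
    rw [lowerFun, integral_eq_zero_of_ae, mul_zero]
    refine Filter.Eventually.of_forall fun x => ?_
    by_cases h0 : F (η.add x) = 0
    · simp [h0]
    · refine (hcon ?_).elim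
      refine le_trans ?_ (hm _ h0)
      rw [Config.toMeasure_add, Measure.add_apply]
      exact le_self_add
  refine ⟨?_, ⟨|Real.sqrt p| * (|D| * |C| * (α.real Set.univ + m)), fun η => ?_⟩, m, hsupp⟩
  · have h : StronglyMeasurable fun q : Config E × E => conj (φ q.2) * F (q.1.add q.2) :=
      ((Complex.continuous_conj.measurable.comp (hφm.comp measurable_snd)).mul
        (hFm.comp Config.measurable_add)).stronglyMeasurable
    exact (h.integral_kernel_prod_right'
      (κ := Kernel.const (Config E) α + Config.kernel E)).measurable.const_mul _
  · by_cases h0 : lowerFun p α φ F η = 0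
    · rw [h0, norm_zero]; positivity
    have hmass : (α + η.toMeasure).real Set.univ ≤ α.real Set.univ + m := by
      have := ENNReal.toReal_mono (ENNReal.natCast_ne_top _) (hsupp η h0)
      rw [ENNReal.toReal_natCast] at this
      rw [measureReal_add_apply]
      exact add_le_add le_rfl this
    rw [lowerFun, norm_mul, Complex.norm_real, Real.norm_eq_abs]
    refine mul_le_mul_of_nonneg_left ?_ (abs_nonneg _)
    refine (norm_integral_le_of_norm_le_const (C := |D| * |C|)
      (Filter.Eventually.of_forall fun x => ?_)).trans
      (mul_le_mul_of_nonneg_left hmass (by positivity))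
    rw [norm_mul, RCLike.norm_conj]
    exact mul_le_mul ((hD x).trans (le_abs_self D)) ((hC _).trans (le_abs_self C))
      (norm_nonneg _) (abs_nonneg _)

/-- `k⁺(φ)` on functions. -/
def raiseLin [StandardBorelSpace E] (p : ℝ) (φ : BddMeasurable E) :
    cutoffFun E →ₗ[ℂ] cutoffFun E where
  toFun F := ⟨raiseFun p φ.1 F.1, raiseFun_mem p φ F.2⟩
  map_add' F G := by
    ext η
    simp only [raiseFun, Submodule.coe_add, Pi.add_apply, mul_add]
    rw [integral_add (integrable_raise φ F.2 η) (integrable_raise φ G.2 η), mul_add]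
  map_smul' c F := by
    ext η
    simp only [raiseFun, Submodule.coe_smul, Pi.smul_apply, smul_eq_mul, RingHom.id_apply]
    simp_rw [mul_left_comm _ c]
    rw [integral_const_mul, mul_left_comm]

/-- `k⁻(φ)` on functions. -/
def lowerLin (p : ℝ) (α : Measure E) [IsFiniteMeasure α] (φ : BddMeasurable E) :
    cutoffFun E →ₗ[ℂ] cutoffFun E where
  toFun F := ⟨lowerFun p α φ.1 F.1, lowerFun_mem p α φ F.2⟩
  map_add' F G := by
    ext η
    simp only [lowerFun, Submodule.coe_add, Pi.add_apply, mul_add]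
    rw [integral_add (integrable_lower α φ F.2 η) (integrable_lower α φ G.2 η), mul_add]
  map_smul' c F := by
    ext η
    simp only [lowerFun, Submodule.coe_smul, Pi.smul_apply, smul_eq_mul, RingHom.id_apply]
    simp_rw [mul_left_comm _ c]
    rw [integral_const_mul, mul_left_comm]

variable (p : Set.Ioo (0 : ℝ) 1) (α : Measure E) [IsFiniteMeasure α]

/-- The Hilbert space `L²(ρ_{p, α})` of complex-valued functions. -/
abbrev Hilb : Type _ := Lp ℂ 2 (pascalLaw p α)

theorem memLp_cutoffFun (F : cutoffFun E) : MemLp F.1 2 (pascalLaw p α) := by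
  obtain ⟨C, hC⟩ := F.2.2.1
  exact MemLp.of_bound F.2.1.aestronglyMeasurable C (Filter.Eventually.of_forall hC)

/-- The map that sends a function to its class in `L²`. -/
def toL2 : cutoffFun E →ₗ[ℂ] Hilb p α where
  toFun F := (memLp_cutoffFun p α F).toLp F.1
  map_add' _ _ := rfl
  map_smul' _ _ := rfl

/-- The domain `𝒟 ⊆ L²(ρ_{p, α})`: the classes of bounded measurable functions with bounded
particle number. -/
abbrev dom : Submodule ℂ (Hilb p α) := LinearMap.range (toL2 p α)

theorem mem_ker_toL2 (F : cutoffFun E) :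
    F ∈ LinearMap.ker (toL2 p α) ↔ F.1 =ᵐ[pascalLaw p α] 0 := by
  rw [LinearMap.mem_ker]
  exact MemLp.toLp_eq_toLp_iff (memLp_cutoffFun p α F) MemLp.zero

theorem raise_ker [StandardBorelSpace E] (φ : BddMeasurable E) :
    LinearMap.ker (toL2 p α) ≤ (LinearMap.ker (toL2 p α)).comap (raiseLin p φ) := by
  intro F hF
  rw [Submodule.mem_comap, mem_ker_toL2]
  rw [mem_ker_toL2] at hF
  have hFm : Measurable F.1 := F.2.1
  have hG : Measurable fun q : Config E × E =>
      Set.indicator {q : Config E × E | q.1.toMeasure {q.2} ≠ 0}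
        (fun q => ‖F.1 (removeAux q)‖ₑ) q :=
    (hFm.comp measurable_removeAux).enorm.indicator
      (Config.measurable_mass (measurableSet_singleton 0)).compl
  have key := isMecke_pascalLaw p α _ hG
  have h0 : ∫⁻ η, ∫⁻ x, Set.indicator {q : Config E × E | q.1.toMeasure {q.2} ≠ 0}
        (fun q => ‖F.1 (removeAux q)‖ₑ) (η.add x, x) ∂(α + η.toMeasure) ∂pascalLaw p α = 0 := by
    rw [lintegral_congr_ae (g := 0), Pi.zero_def, lintegral_zero]
    filter_upwards [hF] with η hη
    rw [lintegral_congr (g := fun _ => 0), lintegral_zero, Pi.zero_apply]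
    intro x
    have hx : (η.add x).toMeasure {x} ≠ 0 := by simp
    simp [Set.indicator, removeAux, Config.remove_add, hη]
  rw [h0, mul_zero, lintegral_eq_zero_iff (measurable_lintegral_kernel hG)] at key
  filter_upwards [key] with η hη
  replace hη := (lintegral_eq_zero_iff (hG.comp (measurable_prodMk_left (x := η)))).1 hη
  change raiseFun p φ.1 F.1 η = 0
  rw [raiseFun, integral_eq_zero_of_ae, mul_zero]
  filter_upwards [hη, removeAux_ae η, η.ae_mass_ne_zero] with x h1 h2 h3
  have : F.1 (η.remove x) = 0 := by simpa [Set.indicator, h3, h2.1] using h1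
  simp [this]

theorem lower_ker (φ : BddMeasurable E) :
    LinearMap.ker (toL2 p α) ≤ (LinearMap.ker (toL2 p α)).comap (lowerLin p α φ) := by
  intro F hF
  rw [Submodule.mem_comap, mem_ker_toL2]
  rw [mem_ker_toL2] at hF
  have hFm : Measurable F.1 := F.2.1
  have key := isMecke_pascalLaw p α (fun q => ‖F.1 q.1‖ₑ) (hFm.comp measurable_fst).enorm
  have h0 : ∫⁻ η, ∫⁻ _, ‖F.1 η‖ₑ ∂η.toMeasure ∂pascalLaw p α = 0 := by
    rw [lintegral_congr_ae (g := 0), Pi.zero_def, lintegral_zero]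
    filter_upwards [hF] with η hη
    simp [hη]
  have hG : Measurable fun q : Config E × E => ‖F.1 (q.1.add q.2)‖ₑ :=
    (hFm.comp Config.measurable_add).enorm
  rw [h0, eq_comm, mul_eq_zero, or_iff_right (by simpa using p.2.1),
    lintegral_eq_zero_iff (measurable_lintegral_add α hG)] at key
  filter_upwards [key] with η hη
  replace hη := (lintegral_eq_zero_iff (hG.comp (measurable_prodMk_left (x := η)))).1 hη
  change lowerFun p α φ.1 F.1 η = 0
  rw [lowerFun, integral_eq_zero_of_ae, mul_zero]
  filter_upwards [hη] with x h1
  have : F.1 (η.add x) = 0 := by simpa using h1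
  simp [this]

/-- An operator on functions that respects almost everywhere equality, as an operator on the
domain `𝒟 ⊆ L²(ρ_{p, α})`. -/
def descend (k : cutoffFun E →ₗ[ℂ] cutoffFun E)
    (hk : LinearMap.ker (toL2 p α) ≤ (LinearMap.ker (toL2 p α)).comap k) :
    dom p α →ₗ[ℂ] dom p α :=
  (toL2 p α).quotKerEquivRange.toLinearMap ∘ₗ Submodule.mapQ _ _ k hk ∘ₗ
    (toL2 p α).quotKerEquivRange.symm.toLinearMap

/-- `descend` acts on the class of `F` by applying the operator to the function `F`. -/
theorem descend_apply (k : cutoffFun E →ₗ[ℂ] cutoffFun E)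
    (hk : LinearMap.ker (toL2 p α) ≤ (LinearMap.ker (toL2 p α)).comap k) (F : cutoffFun E) :
    descend p α k hk ⟨toL2 p α F, F, rfl⟩ = ⟨toL2 p α (k F), k F, rfl⟩ := by
  have : (toL2 p α).quotKerEquivRange.symm ⟨toL2 p α F, F, rfl⟩ = Submodule.Quotient.mk F :=
    (toL2 p α).quotKerEquivRange_symm_apply_image F _
  rw [descend, LinearMap.comp_apply, LinearMap.comp_apply, LinearEquiv.coe_coe,
    LinearEquiv.coe_coe, this]
  rfl

/-- The raising operator `k⁺(φ) : 𝒟 → 𝒟`. -/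
def kPlus [StandardBorelSpace E] (φ : BddMeasurable E) : Module.End ℂ (dom p α) :=
  descend p α (raiseLin p φ) (raise_ker p α φ)

/-- The lowering operator `k⁻(φ) : 𝒟 → 𝒟`. -/
def kMinus (φ : BddMeasurable E) : Module.End ℂ (dom p α) :=
  descend p α (lowerLin p α φ) (lower_ker p α φ)

/-- The operator `(1 / i) (ξ k⁺(1) - conj ξ k⁻(1)) : 𝒟 → 𝒟`. -/
def fieldEnd [StandardBorelSpace E] (ξ : ℂ) : Module.End ℂ (dom p α) :=
  (1 / Complex.I) • (ξ • kPlus p α (one E) - conj ξ • kMinus p α (one E))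

/-- The same operator, as an unbounded operator in `L²(ρ_{p, α})` with domain `𝒟`. -/
def fieldOp [StandardBorelSpace E] (ξ : ℂ) : Hilb p α →ₗ.[ℂ] Hilb p α where
  domain := dom p α
  toFun := (dom p α).subtype ∘ₗ fieldEnd p α ξ

end Operators

end Pascal

end

/-! Write n for the number of points of a configuration, a for the total mass of α, and A for the
field operator. The tool throughout is the Mecke equation `isMecke_pascalLaw`. In its complex form
it says that k⁺ and k⁻ are formally adjoint (`inner_raise`), so A is symmetric. Since its domain is
dense (`denseRange_toL2`), A is closable. Combined with Cauchy–Schwarz, the Mecke equation also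
shows that k⁺(1) followed by multiplication by w(n) is bounded on 𝒟 by the supremum of |w(n + 1)|
√((n + 1)(a + n)), and similarly for k⁻(1) (`norm_weight_raise_le`, `norm_weight_lower_le`). Hence A
grows at most linearly in the number of points.

Self-adjointness of the closure comes from a cutoff argument rather than from the analytic vectors.
Let X_N be multiplication by a function of n that is 1 up to N + 1, vanishes from 2(N + 1) on, and
has slope of size 1/(N + 1). Since k⁺ and k⁻ shift n by one, the commutator of A with X_N only sees
increments of the cutoff. These increments, of size 1/N and living where n is of order N, compensate
the linear growth, so the commutators are bounded uniformly in N (`norm_fieldLin_commutator_le`).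
Each vector of 𝒟 is fixed by X_N for large N, so the commutators also tend to zero strongly.
Therefore X_N transports a pair (g, h) of the graph of the adjoint into pairs of the graph of A that
converge to it (`exists_graph_approx_of_cutoff`). The adjoint is thus the closure of A, and its own
adjoint as well.

Analyticity is a count: on functions with at most m points A has norm at most K(m + 1), and it
raises m by at most one. So the norm of the n-th power is at most K^n (m + 1)⋯(m + n), which after
division by n! is geometric up to a factor polynomial in n. -/

/-! ### Essential self-adjointness of symmetric operators by cutoffs. -/

section EssentialSelfAdjointness

variable {H : Type*} [NormedAddCommGroup H] [InnerProductSpace ℂ H]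

/-- If a symmetric operator `a` commutes, up to uniformly bounded errors, with symmetric contractive
cutoffs `X N` that eventually fix every vector and make `a` bounded, then every element of the
graph of the adjoint is a limit of elements of the graph of `a`. -/
theorem exists_graph_approx_of_cutoff {V : Type*} [AddCommGroup V] [Module ℂ V]
    (j : V →ₗ[ℂ] H) (hj : DenseRange j) (a : V →ₗ[ℂ] V)
    (ha : ∀ u v, inner ℂ (j (a u)) (j v) = inner ℂ (j u) (j (a v)))
    (X : ℕ → V →ₗ[ℂ] V)
    (hX : ∀ N u v, inner ℂ (j (X N u)) (j v) = inner ℂ (j u) (j (X N v)))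
    (hX1 : ∀ N v, ‖j (X N v)‖ ≤ ‖j v‖)
    (hXe : ∀ v, ∀ᶠ N in Filter.atTop, X N v = v)
    (c : ℕ → ℝ) (haX : ∀ N v, ‖j (a (X N v))‖ ≤ c N * ‖j v‖)
    (C : ℝ) (hC : 0 ≤ C) (hcomm : ∀ N v, ‖j (a (X N v) - X N (a v))‖ ≤ C * ‖j v‖)
    {g h : H} (hgh : ∀ v, inner ℂ h (j v) = inner ℂ g (j (a v))) {ε : ℝ} (hε : 0 < ε) :
    ∃ v, ‖j v - g‖ < ε ∧ ‖j (a v) - h‖ < ε := by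
  -- The two errors below come out as 3δ and (3 + 2C)δ; both are covered.
  obtain ⟨δ, hδ, hδε⟩ : ∃ δ : ℝ, 0 < δ ∧ (4 + 2 * C) * δ < ε := by
    refine ⟨ε / (5 + 2 * C), by positivity, ?_⟩
    rw [← mul_div_assoc, div_lt_iff₀ (by positivity)]
    nlinarith
  have happ : ∀ (x : H) {r : ℝ}, 0 < r → ∃ v, ‖j v - x‖ < r := by
    intro x r hr
    obtain ⟨v, hv⟩ := hj.exists_dist_lt x hr
    exact ⟨v, by rwa [dist_comm, dist_eq_norm] at hv⟩
  obtain ⟨g', hg'⟩ := happ g hδ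
  obtain ⟨h', hh'⟩ := happ h hδ
  -- The order of choices matters: N depends on the rough approximants g' and h'. Only then is f
  -- taken so close to g that even the bound `c N`, which may grow with N, is harmless.
  obtain ⟨N, hN1, hN2, hN3⟩ := ((hXe g').and ((hXe (a g')).and (hXe h'))).exists
  have hcN : 0 < |c N| + 1 := by positivity
  obtain ⟨f, hf⟩ := happ g (show 0 < δ / (|c N| + 1) by positivity)
  have hfδ : ‖j f - g‖ ≤ δ :=
    hf.le.trans (div_le_self hδ.le (by linarith [abs_nonneg (c N)]))
  have hfg' : ‖j (f - g')‖ ≤ 2 * δ := by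
    have : j (f - g') = (j f - g) - (j g' - g) := by rw [map_sub]; abel
    rw [this]
    exact (norm_sub_le _ _).trans (by linarith)
  refine ⟨X N f, ?_, ?_⟩
  · have : j (X N f) - g = j (X N (f - g')) + (j g' - g) := by
      rw [map_sub, hN1, map_sub]; abel
    rw [this]
    have h1 := (hX1 N (f - g')).trans hfg'
    exact (norm_add_le _ _).trans_lt (by nlinarith)
  -- The commutator of `a` and `X N` kills g', because `X N` fixes both g' and `a g'`. So its value
  -- at f is its value at f - g', which is small by the uniform bound.
  · have hcf : ‖j (a (X N f) - X N (a f))‖ ≤ 2 * C * δ := by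
      have h1 := hcomm N (f - g')
      have h2 : a (X N (f - g')) - X N (a (f - g')) = a (X N f) - X N (a f) := by
        simp only [map_sub, hN1, hN2]; abel
      rw [h2] at h1
      exact h1.trans (by nlinarith)
    have hweak : ∀ v, ‖inner ℂ (j (a (X N f)) - h) (j v)‖ ≤ (3 + 2 * C) * δ * ‖j v‖ := by
      intro v
      -- Moving `X N` and `a` to the right gives ⟨X a f, v⟩ = ⟨f, a X v⟩, and the adjoint relation
      -- at `X N v` gives ⟨g, a X v⟩ = ⟨h, X v⟩. The remaining ⟨h, X v - v⟩ is small because h is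
      -- near h', which `X N` fixes.
      have e : inner ℂ (j (a (X N f)) - h) (j v) =
          inner ℂ (j (a (X N f) - X N (a f))) (j v) + inner ℂ (j f - g) (j (a (X N v)))
          - inner ℂ (j h' - h) (j (X N v) - j v) := by
        have e1 : inner ℂ (j (X N (a f))) (j v) = inner ℂ (j f) (j (a (X N v))) := by
          rw [hX, ha]
        have e2 : inner ℂ (j h') (j (X N v)) = inner ℂ (j h') (j v) := by
          rw [← hX, hN3]
        have e3 := hgh (X N v)
        simp only [map_sub, inner_sub_left, inner_sub_right, e1, e2, e3]
        ring
      rw [e]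
      have b1 : ‖inner ℂ (j (a (X N f) - X N (a f))) (j v)‖ ≤ 2 * C * δ * ‖j v‖ :=
        (norm_inner_le_norm _ _).trans (by gcongr)
      have b2 : ‖inner ℂ (j f - g) (j (a (X N v)))‖ ≤ δ * ‖j v‖ := by
        refine (norm_inner_le_norm _ _).trans ?_
        calc ‖j f - g‖ * ‖j (a (X N v))‖ ≤ δ / (|c N| + 1) * ((|c N| + 1) * ‖j v‖) := by
              gcongr
              refine (haX N v).trans ?_
              gcongr
              linarith [le_abs_self (c N)]
          _ = δ * ‖j v‖ := by field_simp
      have b3 : ‖inner ℂ (j h' - h) (j (X N v) - j v)‖ ≤ δ * (2 * ‖j v‖) := by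
        refine (norm_inner_le_norm _ _).trans ?_
        gcongr
        exact (norm_sub_le _ _).trans (by linarith [hX1 N v])
      refine (norm_sub_le _ _).trans ((add_le_add (norm_add_le _ _) le_rfl).trans ?_)
      linarith
    -- The weak estimate extends to all of H by density; testing it on the vector itself turns it
    -- into a norm estimate.
    have hall : ∀ x : H, ‖inner ℂ (j (a (X N f)) - h) x‖ ≤ (3 + 2 * C) * δ * ‖x‖ := by
      intro x
      refine hj.induction_on x ?_ hweak
      exact isClosed_le (by fun_prop) (by fun_prop)
    have hself := hall (j (a (X N f)) - h)
    rw [norm_inner_symm, inner_self_eq_norm_sq_to_K] at hself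
    have hself' : ‖j (a (X N f)) - h‖ * ‖j (a (X N f)) - h‖ ≤
        (3 + 2 * C) * δ * ‖j (a (X N f)) - h‖ := by
      simpa [sq] using hself
    rcases (norm_nonneg (j (a (X N f)) - h)).eq_or_lt' with h0 | h0
    · rwa [h0]
    · have := le_of_mul_le_mul_right hself' h0
      linarith

variable [CompleteSpace H]

/-- The adjoint is a closed extension of a symmetric operator. -/
theorem LinearPMap.isClosable_of_symmetric {T : H →ₗ.[ℂ] H} (hd : Dense (T.domain : Set H))
    (hT : T.IsFormalAdjoint T) : T.IsClosable :=
  (LinearPMap.adjoint_isClosed hd).isClosable.leIsClosable (hT.le_adjoint hd)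

/-- A densely defined symmetric operator is essentially self-adjoint if the graph of its adjoint is
contained in the closure of its graph. -/
theorem LinearPMap.isSelfAdjoint_closure_of_adjoint_graph_le {T : H →ₗ.[ℂ] H}
    (hd : Dense (T.domain : Set H)) (hT : T.IsFormalAdjoint T)
    (hle : T.adjoint.graph ≤ T.graph.topologicalClosure) : IsSelfAdjoint T.closure := by
  have hc := T.isClosable_of_symmetric hd hT
  have hd' : Dense (T.closure.domain : Set H) := hd.mono T.le_closure.1
  have h1 : T.closure.graph = T.adjoint.graph := by
    rw [← hc.graph_closure_eq_closure_graph]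
    refine le_antisymm ?_ hle
    exact Submodule.topologicalClosure_minimal _ (LinearPMap.le_graph_of_le (hT.le_adjoint hd))
      (LinearPMap.adjoint_isClosed hd)
  rw [LinearPMap.isSelfAdjoint_def]
  -- The relation that defines the adjoint is closed in the pair it is tested on, so an operator and
  -- its closure have the same adjoint.
  refine LinearPMap.eq_of_eq_graph ?_
  rw [h1, LinearPMap.adjoint_graph_eq_graph_adjoint hd', LinearPMap.adjoint_graph_eq_graph_adjoint hd,
    ← hc.graph_closure_eq_closure_graph]
  ext ⟨x, y⟩
  simp only [Submodule.mem_adjoint_iff]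
  refine ⟨fun h a b hab => h a b (Submodule.le_topologicalClosure _ hab), fun h a b hab => ?_⟩
  have hcl : _root_.IsClosed {q : H × H | inner ℂ q.2 x - inner ℂ q.1 y = 0} :=
    isClosed_eq (by fun_prop) continuous_const
  exact closure_minimal (fun q hq => h q.1 q.2 hq) hcl hab

end EssentialSelfAdjointness

/-! ### The number of points and multiplication by its functions. -/

namespace Pascal

variable {E : Type*} [MeasurableSpace E]

namespace Config

/-- The total number of points of a configuration. -/
noncomputable abbrev num (η : Config E) : ℕ := cnt Set.univ η

theorem measurable_num : Measurable (num : Config E → ℕ) := measurable_cnt MeasurableSet.univ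

theorem cast_num (η : Config E) : (η.num : ℝ≥0∞) = η.toMeasure Set.univ :=
  cast_cnt MeasurableSet.univ η

theorem num_add (η : Config E) (x : E) : (η.add x).num = η.num + 1 := by
  classical
  simp [num, cnt_add MeasurableSet.univ]

theorem num_le_iff (η : Config E) (m : ℕ) : η.num ≤ m ↔ η.toMeasure Set.univ ≤ m := by
  rw [← cast_num]; exact_mod_cast Iff.rfl

end Config

theorem exists_cutoff (F : cutoffFun E) : ∃ m : ℕ, ∀ η, F.1 η ≠ 0 → η.num ≤ m := by
  obtain ⟨m, hm⟩ := F.2.2.2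
  exact ⟨m, fun η h => (η.num_le_iff m).2 (hm η h)⟩

/-- Multiplication by a function of the number of points. -/
noncomputable def weight (w : ℕ → ℝ) : cutoffFun E →ₗ[ℂ] cutoffFun E where
  toFun F := ⟨fun η => (w η.num : ℂ) * F.1 η, by
    obtain ⟨hFm, ⟨C, hC⟩, m, hm⟩ := F.2
    refine ⟨((Complex.measurable_ofReal.comp
      ((measurable_of_countable w).comp Config.measurable_num)).mul hFm),
      -- `w` may be unbounded; only its values up to the cutoff of F enter.
      ⟨(∑ k ∈ Finset.range (m + 1), |w k|) * |C|, fun η => ?_⟩, m,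
      fun η h => hm η fun h0 => h (by simp [h0])⟩
    by_cases h0 : F.1 η = 0
    · simp only [h0, mul_zero, norm_zero]; positivity
    · rw [norm_mul, Complex.norm_real, Real.norm_eq_abs]
      refine mul_le_mul ?_ ((hC η).trans (le_abs_self C)) (norm_nonneg _) (by positivity)
      exact Finset.single_le_sum (f := fun k => |w k|) (fun k _ => abs_nonneg (w k))
        (Finset.mem_range.2 (Nat.lt_succ_of_le ((η.num_le_iff m).2 (hm η h0))))⟩
  map_add' F G := by ext η; simp [mul_add]
  map_smul' c F := by ext η; simp [mul_left_comm]

@[simp] theorem weight_apply (w : ℕ → ℝ) (F : cutoffFun E) (η : Config E) :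
    (weight w F).1 η = (w η.num : ℂ) * F.1 η := rfl

theorem weight_eq_self {w : ℕ → ℝ} {F : cutoffFun E} (h : ∀ η, F.1 η ≠ 0 → w η.num = 1) :
    weight w F = F := by
  ext η
  by_cases h0 : F.1 η = 0
  · simp [h0]
  · simp [h η h0]

theorem weight_sub (v w : ℕ → ℝ) (F : cutoffFun E) :
    weight (fun n => v n - w n) F = weight v F - weight w F := by
  ext η; simp [sub_mul]

/-! ### Commutation of the raising and lowering operators with weights. -/

section Operators

variable (p : ℝ) (α : Measure E) [IsFiniteMeasure α]

/-- Removing a point lowers the number of points by one. At the empty configuration the truncated `n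
- 1` is harmless, since the integral there is over the zero measure. -/
theorem raise_weight [StandardBorelSpace E] (φ : BddMeasurable E) (w : ℕ → ℝ)
    (F : cutoffFun E) :
    raiseLin p φ (weight w F) = weight (fun n => w (n - 1)) (raiseLin p φ F) := by
  ext η
  change raiseFun p φ.1 _ η = _ * raiseFun p φ.1 F.1 η
  rw [raiseFun, raiseFun, mul_left_comm]
  congr 1
  rw [← integral_const_mul]
  refine integral_congr_ae ?_
  filter_upwards [removeAux_ae η] with x hx
  have : η.num - 1 = (η.remove x).num := by
    conv_lhs => rw [← hx.2, Config.num_add]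
    simp
  rw [weight_apply, this]
  ring

theorem lower_weight (φ : BddMeasurable E) (w : ℕ → ℝ) (F : cutoffFun E) :
    lowerLin p α φ (weight w F) = weight (fun n => w (n + 1)) (lowerLin p α φ F) := by
  ext η
  change lowerFun p α φ.1 _ η = _ * lowerFun p α φ.1 F.1 η
  rw [lowerFun, lowerFun, mul_left_comm]
  congr 1
  rw [← integral_const_mul]
  refine integral_congr_ae (Filter.Eventually.of_forall fun x => ?_)
  simp only [weight_apply, Config.num_add]
  ring

theorem removeAux_add [MeasurableSingletonClass E] (η : Config E) (x : E) :
    removeAux (η.add x, x) = η := by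
  simp [removeAux, Config.remove_add]

/-- The Cauchy–Schwarz inequality against the constant function. -/
theorem enorm_integral_sq_le {X : Type*} [MeasurableSpace X] (μ : Measure X) {f : X → ℂ}
    (hf : AEStronglyMeasurable f μ) :
    ‖∫ x, f x ∂μ‖ₑ ^ 2 ≤ μ Set.univ * ∫⁻ x, ‖f x‖ₑ ^ 2 ∂μ := by
  have h := ENNReal.lintegral_mul_le_Lp_mul_Lq μ Real.HolderConjugate.two_two
    (f := fun _ => 1) (g := fun x => ‖f x‖ₑ) aemeasurable_const hf.enorm
  have h2 : ‖∫ x, f x ∂μ‖ₑ ≤ (μ Set.univ) ^ (1 / 2 : ℝ) *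
      (∫⁻ x, ‖f x‖ₑ ^ (2 : ℝ) ∂μ) ^ (1 / 2 : ℝ) := by
    refine (enorm_integral_le_lintegral_enorm f).trans ?_
    simpa using h
  have h3 := pow_le_pow_left' h2 2
  rw [mul_pow, ← ENNReal.rpow_natCast, ← ENNReal.rpow_natCast (_ ^ (1 / 2 : ℝ)),
    ← ENNReal.rpow_natCast (_ ^ (1 / 2 : ℝ)), ← ENNReal.rpow_mul, ← ENNReal.rpow_mul] at h3
  simpa using h3

end Operators

/-! ### Weighted norm bounds from Cauchy–Schwarz and the Mecke equation. -/

section Estimates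

variable (p : Set.Ioo (0 : ℝ) 1) (α : Measure E) [IsFiniteMeasure α]

theorem enorm_toL2_sq (F : cutoffFun E) :
    ‖toL2 p α F‖ₑ ^ 2 = ∫⁻ η, ‖F.1 η‖ₑ ^ 2 ∂pascalLaw p α := by
  change ‖(memLp_cutoffFun p α F).toLp F.1‖ₑ ^ 2 = _
  rw [Lp.enorm_toLp]
  simpa using eLpNorm_nnreal_pow_eq_lintegral (p := 2) (μ := pascalLaw p α) (f := F.1) (by simp)

theorem norm_toL2_le_of_lintegral_le {F G : cutoffFun E} {c : ℝ} (hc : 0 ≤ c)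
    (h : ∫⁻ η, ‖F.1 η‖ₑ ^ 2 ∂pascalLaw p α ≤
      ENNReal.ofReal (c ^ 2) * ∫⁻ η, ‖G.1 η‖ₑ ^ 2 ∂pascalLaw p α) :
    ‖toL2 p α F‖ ≤ c * ‖toL2 p α G‖ := by
  rw [← enorm_toL2_sq, ← enorm_toL2_sq, ← ofReal_norm, ← ofReal_norm,
    ← ENNReal.ofReal_pow (norm_nonneg _), ← ENNReal.ofReal_pow (norm_nonneg _),
    ← ENNReal.ofReal_mul (by positivity), ENNReal.ofReal_le_ofReal_iff (by positivity),
    ← mul_pow] at h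
  exact le_of_sq_le_sq h (by positivity)

theorem enorm_ofReal_mul_sq (a : ℝ) (z : ℂ) :
    ‖(a : ℂ) * z‖ₑ ^ 2 = ENNReal.ofReal (a ^ 2) * ‖z‖ₑ ^ 2 := by
  rw [enorm_mul, mul_pow, ← ofReal_norm (a : ℂ), Complex.norm_real, Real.norm_eq_abs,
    ← ENNReal.ofReal_pow (abs_nonneg a), sq_abs]

theorem measurable_weightENN (w : ℕ → ℝ≥0∞) : Measurable fun η : Config E => w η.num :=
  (measurable_of_countable w).comp Config.measurable_num

theorem norm_weight_le {w : ℕ → ℝ} {c : ℝ} (hc : 0 ≤ c) {F : cutoffFun E}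
    (h : ∀ η, F.1 η ≠ 0 → w η.num ^ 2 ≤ c ^ 2) :
    ‖toL2 p α (weight w F)‖ ≤ c * ‖toL2 p α F‖ := by
  refine norm_toL2_le_of_lintegral_le p α hc ?_
  rw [← lintegral_const_mul' _ _ ENNReal.ofReal_ne_top]
  refine lintegral_mono fun η => ?_
  rw [weight_apply, enorm_ofReal_mul_sq]
  by_cases h0 : F.1 η = 0
  · simp [h0]
  · gcongr ENNReal.ofReal ?_ * _
    exact h η h0

theorem alpha_add_univ (η : Config E) :
    (α + η.toMeasure) Set.univ = ENNReal.ofReal (α.real Set.univ + η.num) := by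
  rw [Measure.add_apply, ← Config.cast_num, ENNReal.ofReal_add measureReal_nonneg (by positivity)]
  simp

/-- Cauchy–Schwarz for η(dx) bounds |k⁺F(η)|² by n/p times the integral of |F(η - δ_x)|². The Mecke
equation then replaces η by η + δ_x: its factor p cancels 1/p, n becomes n + 1, and the integrand no
longer depends on x, so integrating over α + η gives the factor a + n. -/
theorem norm_weight_raise_le [StandardBorelSpace E] {w : ℕ → ℝ} {c : ℝ} (hc : 0 ≤ c)
    {F : cutoffFun E}
    (h : ∀ η, F.1 η ≠ 0 →
      w (η.num + 1) ^ 2 * ((η.num + 1) * (α.real Set.univ + η.num)) ≤ c ^ 2) :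
    ‖toL2 p α (weight w (raiseLin p (one E) F))‖ ≤ c * ‖toL2 p α F‖ := by
  have hp : (0 : ℝ) < p := p.2.1
  have hFm : Measurable F.1 := F.2.1
  refine norm_toL2_le_of_lintegral_le p α hc ?_
  -- The weight and the Cauchy–Schwarz factor are absorbed into G; `removeAux` makes it jointly
  -- measurable.
  let G : Config E × E → ℝ≥0∞ := fun q =>
    ENNReal.ofReal (w q.1.num ^ 2 * q.1.num) * ‖F.1 (removeAux q)‖ₑ ^ 2
  have hG : Measurable G :=
    ((measurable_weightENN fun n => ENNReal.ofReal (w n ^ 2 * n)).comp measurable_fst).mul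
      ((hFm.comp measurable_removeAux).enorm.pow_const 2)
  have hpt : ∀ η : Config E, ‖(weight w (raiseLin p (one E) F)).1 η‖ₑ ^ 2 ≤
      ENNReal.ofReal (1 / p) * ∫⁻ x, G (η, x) ∂η.toMeasure := by
    intro η
    have hm : Measurable fun x => F.1 (removeAux (η, x)) :=
      hFm.comp (measurable_removeAux.comp measurable_prodMk_left)
    have e : (raiseLin p (one E) F).1 η =
        ((1 / Real.sqrt p : ℝ) : ℂ) * ∫ x, F.1 (removeAux (η, x)) ∂η.toMeasure := by
      change raiseFun p (one E).1 F.1 η = _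
      rw [raiseFun, raise_integral_eq]
      simp [one]
    rw [weight_apply, e, enorm_ofReal_mul_sq, enorm_ofReal_mul_sq, div_pow, one_pow,
      Real.sq_sqrt hp.le, mul_left_comm]
    gcongr
    simp only [G]
    rw [lintegral_const_mul _ (hm.enorm.pow_const 2), ENNReal.ofReal_mul (sq_nonneg _), mul_assoc]
    gcongr
    refine (enorm_integral_sq_le _ hm.aestronglyMeasurable).trans_eq ?_
    rw [← Config.cast_num, ENNReal.ofReal_natCast]
  refine (lintegral_mono hpt).trans ?_
  rw [lintegral_const_mul _ (measurable_lintegral_kernel hG), isMecke_pascalLaw p α G hG,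
    ← mul_assoc, ← ENNReal.ofReal_mul (by positivity), one_div_mul_cancel hp.ne',
    ENNReal.ofReal_one, one_mul, ← lintegral_const_mul' _ _ ENNReal.ofReal_ne_top]
  refine lintegral_mono fun η => ?_
  have e2 : ∀ x, G (η.add x, x) = ENNReal.ofReal (w (η.num + 1) ^ 2 * (η.num + 1)) *
      ‖F.1 η‖ₑ ^ 2 := by
    intro x
    simp [G, Config.num_add, removeAux_add]
  simp_rw [e2]
  rw [lintegral_const, alpha_add_univ, mul_right_comm,
    ← ENNReal.ofReal_mul (by positivity), mul_assoc (w _ ^ 2)]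
  by_cases h0 : F.1 η = 0
  · simp [h0]
  · gcongr
    exact h η h0

/-- The Mecke equation is used in the other direction: Cauchy–Schwarz for α + η gives an integral
over η + δ_x, which becomes an integral over η(dx) of a function of η alone and yields a factor n.
With n = k + 1 this is the same product (k + 1)(a + k) as for the raising operator. -/
theorem norm_weight_lower_le {w : ℕ → ℝ} {c : ℝ} (hc : 0 ≤ c) {F : cutoffFun E}
    (h : ∀ η, F.1 η ≠ 0 → ∀ k, η.num = k + 1 →
      w k ^ 2 * ((k + 1) * (α.real Set.univ + k)) ≤ c ^ 2) :
    ‖toL2 p α (weight w (lowerLin p α (one E) F))‖ ≤ c * ‖toL2 p α F‖ := by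
  have hp : (0 : ℝ) < p := p.2.1
  have hFm : Measurable F.1 := F.2.1
  refine norm_toL2_le_of_lintegral_le p α hc ?_
  -- The argument is shifted by one so that at η + δ_x this is the weight belonging to η. Its value
  -- at 0 is immaterial: the empty configuration contributes the factor n = 0.
  let b : ℕ → ℝ := fun n => w (n - 1) ^ 2 * (α.real Set.univ + (n - 1 : ℕ))
  let G : Config E × E → ℝ≥0∞ := fun q => ENNReal.ofReal (b q.1.num) * ‖F.1 q.1‖ₑ ^ 2
  have hG : Measurable G :=
    ((measurable_weightENN fun n => ENNReal.ofReal (b n)).comp measurable_fst).mul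
      ((hFm.comp measurable_fst).enorm.pow_const 2)
  have hG1 : Measurable fun q : Config E × E => G (q.1.add q.2, q.2) :=
    hG.comp (Config.measurable_add.prodMk measurable_snd)
  have hpt : ∀ η : Config E, ‖(weight w (lowerLin p α (one E) F)).1 η‖ₑ ^ 2 ≤
      ENNReal.ofReal p * ∫⁻ x, G (η.add x, x) ∂(α + η.toMeasure) := by
    intro η
    have hm : Measurable fun x => F.1 (η.add x) :=
      hFm.comp (Config.measurable_add.comp measurable_prodMk_left)
    have e : (lowerLin p α (one E) F).1 η =
        ((Real.sqrt p : ℝ) : ℂ) * ∫ x, F.1 (η.add x) ∂(α + η.toMeasure) := by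
      change lowerFun p α (one E).1 F.1 η = _
      simp [lowerFun, one]
    rw [weight_apply, e, enorm_ofReal_mul_sq, enorm_ofReal_mul_sq, Real.sq_sqrt hp.le,
      mul_left_comm]
    gcongr
    simp only [G, b, Config.num_add, Nat.add_sub_cancel]
    rw [lintegral_const_mul _ (hm.enorm.pow_const 2), ENNReal.ofReal_mul (sq_nonneg _), mul_assoc]
    gcongr
    refine (enorm_integral_sq_le _ hm.aestronglyMeasurable).trans_eq ?_
    rw [alpha_add_univ]
  refine (lintegral_mono hpt).trans ?_
  rw [lintegral_const_mul _ (measurable_lintegral_add α hG1), ← isMecke_pascalLaw p α G hG,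
    ← lintegral_const_mul' _ _ ENNReal.ofReal_ne_top]
  refine lintegral_mono fun η => ?_
  simp only [G]
  rw [lintegral_const, ← Config.cast_num, mul_right_comm, ← ENNReal.ofReal_natCast,
    ← ENNReal.ofReal_mul (by positivity)]
  by_cases h0 : F.1 η = 0
  · simp [h0]
  · gcongr
    rcases hn : η.num with _ | k
    · simpa using sq_nonneg c
    · have := h η h0 k hn
      simp only [b, Nat.add_sub_cancel]
      push_cast
      linarith

theorem norm_field_combination_le (ξ : ℂ) (F G : cutoffFun E) :
    ‖toL2 p α ((1 / Complex.I) • (ξ • F - conj ξ • G))‖ ≤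
      ‖ξ‖ * (‖toL2 p α F‖ + ‖toL2 p α G‖) := by
  rw [map_smul, map_sub, map_smul, map_smul, norm_smul, mul_add]
  have h := norm_sub_le (ξ • toL2 p α F) (conj ξ • toL2 p α G)
  rw [norm_smul, norm_smul, RCLike.norm_conj] at h
  simpa using h

end Estimates

/-! ### Formal adjointness of the raising and lowering operators. -/

section Symmetry

variable (p : Set.Ioo (0 : ℝ) 1) (α : Measure E) [IsFiniteMeasure α]

theorem inner_toL2 (F G : cutoffFun E) :
    inner ℂ (toL2 p α F) (toL2 p α G) = ∫ η, conj (F.1 η) * G.1 η ∂pascalLaw p α := by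
  rw [L2.inner_def]
  refine integral_congr_ae ?_
  filter_upwards [(memLp_cutoffFun p α F).coeFn_toLp, (memLp_cutoffFun p α G).coeFn_toLp]
    with η h1 h2
  change inner ℂ ((memLp_cutoffFun p α F).toLp F.1 η) ((memLp_cutoffFun p α G).toLp G.1 η) = _
  rw [h1, h2, RCLike.inner_apply, mul_comm]

theorem inner_weight (w : ℕ → ℝ) (F G : cutoffFun E) :
    inner ℂ (toL2 p α (weight w F)) (toL2 p α G) =
      inner ℂ (toL2 p α F) (toL2 p α (weight w G)) := by
  rw [inner_toL2, inner_toL2]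
  congr 1
  ext η
  simp only [weight_apply, map_mul, Complex.conj_ofReal]
  ring

/-- The Mecke equation as an identity of measures on pairs of a configuration and a point. -/
theorem compProd_kernel_eq :
    (pascalLaw p α).compProd (Config.kernel E) = ENNReal.ofReal p •
      ((pascalLaw p α).compProd (Kernel.const _ α + Config.kernel E)).map
        fun q => (q.1.add q.2, q.2) := by
  have hm : Measurable fun q : Config E × E => (q.1.add q.2, q.2) :=
    Config.measurable_add.prodMk measurable_snd
  refine Measure.ext fun S hS => ?_
  have h1 : Measurable (S.indicator (1 : Config E × E → ℝ≥0∞)) := measurable_one.indicator hS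
  rw [← lintegral_indicator_one hS, ← lintegral_indicator_one hS, lintegral_smul_measure,
    lintegral_map h1 hm, Measure.lintegral_compProd h1,
    Measure.lintegral_compProd (f := fun q : Config E × E => S.indicator 1 (q.1.add q.2, q.2))
      (h1.comp hm)]
  exact isMecke_pascalLaw p α _ h1

/-- All factors are bounded, and G vanishes beyond m points, so the inner integral is over a measure
of mass at most m wherever it does not vanish. -/
theorem integrable_compProd_kernel [StandardBorelSpace E] (φ : BddMeasurable E)
    (F G : cutoffFun E) :
    Integrable (fun q : Config E × E => conj (φ.1 q.2 * F.1 (removeAux q)) * G.1 q.1)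
      ((pascalLaw p α).compProd (Config.kernel E)) := by
  obtain ⟨φ, hφm, D, hD⟩ := φ
  obtain ⟨m, hm⟩ := exists_cutoff G
  obtain ⟨hFm, ⟨C, hC⟩, -⟩ := F.2
  obtain ⟨hGm, ⟨C', hC'⟩, -⟩ := G.2
  have hK : Measurable fun q : Config E × E => conj (φ q.2 * F.1 (removeAux q)) * G.1 q.1 :=
    (Complex.continuous_conj.measurable.comp
      ((hφm.comp measurable_snd).mul (hFm.comp measurable_removeAux))).mul
      (hGm.comp measurable_fst)
  refine ⟨hK.aestronglyMeasurable, ?_⟩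
  rw [HasFiniteIntegral, Measure.lintegral_compProd hK.enorm]
  have hb : ∀ η : Config E, ∫⁻ x, ‖conj (φ x * F.1 (removeAux (η, x))) * G.1 η‖ₑ
      ∂(Config.kernel E η) ≤ ENNReal.ofReal (|D| * |C| * |C'|) * m := by
    intro η
    by_cases h0 : G.1 η = 0
    · simp [h0]
    calc _ ≤ ∫⁻ _, ENNReal.ofReal (|D| * |C| * |C'|) ∂(Config.kernel E η) := by
          refine lintegral_mono fun x => ?_
          rw [← ofReal_norm]
          refine ENNReal.ofReal_le_ofReal ?_
          rw [norm_mul, RCLike.norm_conj, norm_mul]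
          gcongr
          · exact (hD x).trans (le_abs_self D)
          · exact (hC _).trans (le_abs_self C)
          · exact (hC' _).trans (le_abs_self C')
      _ ≤ _ := by
          rw [lintegral_const, Config.kernel_apply, ← Config.cast_num]
          gcongr
          exact hm η h0
  calc _ ≤ ∫⁻ _, ENNReal.ofReal (|D| * |C| * |C'|) * m ∂pascalLaw p α := lintegral_mono hb
    _ < ∞ := by
      rw [lintegral_const, measure_univ, mul_one]
      exact ENNReal.mul_lt_top ENNReal.ofReal_lt_top (ENNReal.natCast_lt_top m)

/-- The Mecke equation for complex-valued integrable functions. -/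
theorem integral_mecke {K : Config E × E → ℂ}
    (hK : Integrable K ((pascalLaw p α).compProd (Config.kernel E))) :
    ∫ η, ∫ x, K (η, x) ∂η.toMeasure ∂pascalLaw p α =
      (p : ℝ) * ∫ η, ∫ x, K (η.add x, x) ∂(α + η.toMeasure) ∂pascalLaw p α := by
  have hp : (0 : ℝ) < p := p.2.1
  have hm : Measurable fun q : Config E × E => (q.1.add q.2, q.2) :=
    Config.measurable_add.prodMk measurable_snd
  have hK2 := hK
  rw [compProd_kernel_eq, integrable_smul_measure (by simpa using hp) ENNReal.ofReal_ne_top] at hK2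
  have hK3 : Integrable (fun q : Config E × E => K (q.1.add q.2, q.2))
      ((pascalLaw p α).compProd (Kernel.const _ α + Config.kernel E)) := hK2.comp_measurable hm
  have h1 := Measure.integral_compProd hK
  have h2 := Measure.integral_compProd hK3
  rw [compProd_kernel_eq, integral_smul_measure, ENNReal.toReal_ofReal hp.le,
    integral_map hm.aemeasurable hK2.aestronglyMeasurable, h2, Complex.real_smul] at h1
  exact h1.symm

/-- This is the Mecke equation for K(η, x) = conj(φ(x) F(η - δ_x)) G(η). The prefactors match
because p/√p = √p. -/
theorem inner_raise [StandardBorelSpace E] (φ : BddMeasurable E) (F G : cutoffFun E) :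
    inner ℂ (toL2 p α (raiseLin p φ F)) (toL2 p α G) =
      inner ℂ (toL2 p α F) (toL2 p α (lowerLin p α φ G)) := by
  have hp : (0 : ℝ) < p := p.2.1
  set K : Config E × E → ℂ := fun q => conj (φ.1 q.2 * F.1 (removeAux q)) * G.1 q.1 with hKdef
  have key := integral_mecke p α (K := K) (integrable_compProd_kernel p α φ F G)
  have hs : ((Real.sqrt p : ℝ) : ℂ) ≠ 0 := by
    exact_mod_cast (Real.sqrt_pos.2 hp).ne'
  have hs2 : ((p : ℝ) : ℂ) = (Real.sqrt p : ℝ) * (Real.sqrt p : ℝ) := by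
    rw [← Complex.ofReal_mul, Real.mul_self_sqrt hp.le]
  have e1 : ∀ η, conj ((raiseLin p φ F).1 η) * G.1 η =
      ((1 / Real.sqrt p : ℝ) : ℂ) * ∫ x, K (η, x) ∂η.toMeasure := by
    intro η
    change conj (raiseFun p φ.1 F.1 η) * G.1 η = _
    rw [raiseFun, raise_integral_eq, map_mul, Complex.conj_ofReal, ← integral_conj, mul_assoc,
      ← integral_mul_const]
  have e2 : ∀ η, conj (F.1 η) * (lowerLin p α φ G).1 η =
      (Real.sqrt p : ℝ) * ∫ x, K (η.add x, x) ∂(α + η.toMeasure) := by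
    intro η
    change conj (F.1 η) * lowerFun p α φ.1 G.1 η = _
    rw [lowerFun, mul_left_comm, ← integral_const_mul]
    congr 2
    ext x
    simp only [hKdef, removeAux_add, map_mul]
    ring
  rw [inner_toL2, inner_toL2]
  simp_rw [e1, e2]
  rw [integral_const_mul, integral_const_mul, key, hs2]
  push_cast
  field_simp

theorem inner_lower [StandardBorelSpace E] (φ : BddMeasurable E) (F G : cutoffFun E) :
    inner ℂ (toL2 p α (lowerLin p α φ F)) (toL2 p α G) =
      inner ℂ (toL2 p α F) (toL2 p α (raiseLin p φ G)) := by
  rw [← inner_conj_symm, ← inner_raise, inner_conj_symm]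

end Symmetry

/-! ### Density of the domain. -/

section Density

variable (p : Set.Ioo (0 : ℝ) 1) (α : Measure E) [IsFiniteMeasure α]

/-- A vector g orthogonal to the domain integrates to zero over every measurable set of
configurations with at most m points, so it vanishes almost everywhere there. Every configuration is
finite, so these sets exhaust the space. -/
theorem denseRange_toL2 : DenseRange (toL2 p α) := by
  have : (dom p α).topologicalClosure = ⊤ := by
    rw [Submodule.topologicalClosure_eq_top_iff, Submodule.eq_bot_iff]
    intro g hg
    rw [Submodule.mem_orthogonal] at hg
    have hgi : Integrable g (pascalLaw p α) := (Lp.memLp g).integrable (by norm_num)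
    have hS : ∀ m : ℕ, MeasurableSet {η : Config E | η.num ≤ m} := fun m =>
      Config.measurable_num measurableSet_Iic
    have key : ∀ m : ℕ, {η : Config E | η.num ≤ m}.indicator g =ᵐ[pascalLaw p α] 0 := by
      intro m
      refine (hgi.indicator (hS m)).ae_eq_zero_of_forall_setIntegral_eq_zero fun T hT _ => ?_
      rw [setIntegral_indicator (hS m)]
      have hTm := hT.inter (hS m)
      let F : cutoffFun E := ⟨(T ∩ {η | η.num ≤ m}).indicator 1, measurable_one.indicator hTm,
        ⟨1, fun η => by
          by_cases h : η ∈ T ∩ {η | η.num ≤ m} <;> simp [Set.indicator, h]⟩, m, fun η h =>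
          (η.num_le_iff m).1 (Set.mem_of_indicator_ne_zero h).2⟩
      have h0 := hg (toL2 p α F) ⟨F, rfl⟩
      rw [L2.inner_def] at h0
      rw [← h0, ← integral_indicator hTm]
      refine integral_congr_ae ?_
      filter_upwards [(memLp_cutoffFun p α F).coeFn_toLp] with η hη
      change _ = inner ℂ ((memLp_cutoffFun p α F).toLp F.1 η) (g η)
      rw [hη]
      by_cases h : η ∈ T ∩ {η | η.num ≤ m} <;> simp [F, Set.indicator, h]
    rw [Lp.eq_zero_iff_ae_eq_zero]
    filter_upwards [ae_all_iff.2 key] with η hη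
    simpa [Set.indicator] using hη η.num
  have h2 : Dense ((dom p α : Submodule ℂ (Hilb p α)) : Set (Hilb p α)) :=
    Submodule.dense_iff_topologicalClosure_eq_top.2 this
  rwa [DenseRange, ← LinearMap.coe_range]

end Density

/-! ### The field operator on functions: symmetry and growth. -/

section Field

variable (p : Set.Ioo (0 : ℝ) 1) (α : Measure E) [IsFiniteMeasure α] [StandardBorelSpace E]

/-- The operator `(1 / i) (ξ k⁺(1) - conj ξ k⁻(1))` on functions. -/
noncomputable def fieldLin (ξ : ℂ) : cutoffFun E →ₗ[ℂ] cutoffFun E :=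
  (1 / Complex.I) • (ξ • raiseLin p (one E) - conj ξ • lowerLin p α (one E))

theorem fieldLin_apply (ξ : ℂ) (F : cutoffFun E) : fieldLin p α ξ F =
    (1 / Complex.I) • (ξ • raiseLin p (one E) F - conj ξ • lowerLin p α (one E) F) := rfl

theorem fieldEnd_toL2 (ξ : ℂ) (F : cutoffFun E) :
    fieldEnd p α ξ ⟨toL2 p α F, F, rfl⟩ =
      ⟨toL2 p α (fieldLin p α ξ F), fieldLin p α ξ F, rfl⟩ := by
  ext1
  simp only [fieldEnd, LinearMap.smul_apply, LinearMap.sub_apply, kPlus, kMinus, descend_apply,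
    fieldLin_apply, map_smul, map_sub, Submodule.coe_smul, AddSubgroupClass.coe_sub]

theorem fieldEnd_pow_toL2 (ξ : ℂ) (F : cutoffFun E) (n : ℕ) :
    (fieldEnd p α ξ ^ n) ⟨toL2 p α F, F, rfl⟩ =
      ⟨toL2 p α ((fieldLin p α ξ ^ n) F), (fieldLin p α ξ ^ n) F, rfl⟩ := by
  induction n with
  | zero => rfl
  | succ n ih => rw [pow_succ', Module.End.mul_apply, ih, fieldEnd_toL2, pow_succ',
      Module.End.mul_apply]

/-- By mutual adjointness ξ k⁺ - conj ξ k⁻ is antisymmetric, and the factor 1/i makes it symmetric.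
-/
theorem inner_fieldLin (ξ : ℂ) (F G : cutoffFun E) :
    inner ℂ (toL2 p α (fieldLin p α ξ F)) (toL2 p α G) =
      inner ℂ (toL2 p α F) (toL2 p α (fieldLin p α ξ G)) := by
  simp only [fieldLin_apply, map_smul, map_sub, inner_smul_left, inner_smul_right,
    inner_sub_left, inner_sub_right, inner_raise, inner_lower]
  simp
  ring

/-- On functions with at most `m` points, the field operator is bounded by a multiple of `m + 1`. -/
theorem norm_fieldLin_le (ξ : ℂ) {F : cutoffFun E} {m : ℕ} (hm : ∀ η, F.1 η ≠ 0 → η.num ≤ m) :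
    ‖toL2 p α (fieldLin p α ξ F)‖ ≤
      2 * ‖ξ‖ * (α.real Set.univ + 1) * (m + 1) * ‖toL2 p α F‖ := by
  have ha : 0 ≤ α.real Set.univ := measureReal_nonneg
  have hc : 0 ≤ (α.real Set.univ + 1) * (m + 1) := by positivity
  have hb : ∀ k : ℕ, k ≤ m → (1 : ℝ) ^ 2 * ((k + 1) * (α.real Set.univ + k)) ≤
      ((α.real Set.univ + 1) * (m + 1)) ^ 2 := by
    intro k hk
    have hk' : (k : ℝ) ≤ m := by exact_mod_cast hk
    have hk0 : (0 : ℝ) ≤ k := by positivity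
    have h1 : (k : ℝ) + 1 ≤ (α.real Set.univ + 1) * (m + 1) := by nlinarith
    have h2 : α.real Set.univ + k ≤ (α.real Set.univ + 1) * (m + 1) := by nlinarith
    rw [one_pow, one_mul, sq]
    exact mul_le_mul h1 h2 (by positivity) hc
  -- The weight 1 turns the weighted bounds into bounds for the operators themselves.
  have h1 := norm_weight_raise_le p α (w := fun _ => 1) hc (F := F)
    (fun η h => hb _ (hm η h))
  have h2 := norm_weight_lower_le p α (w := fun _ => 1) hc (F := F)
    (fun η h k hk => hb k (by have := hm η h; omega))
  rw [weight_eq_self fun _ _ => rfl] at h1 h2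
  rw [fieldLin_apply]
  refine (norm_field_combination_le p α ξ _ _).trans ?_
  calc _ ≤ ‖ξ‖ * ((α.real Set.univ + 1) * (m + 1) * ‖toL2 p α F‖ +
        (α.real Set.univ + 1) * (m + 1) * ‖toL2 p α F‖) := by gcongr
    _ = _ := by ring

/-- F is unchanged by the weight that indicates n ≤ m. The commutation rules turn it into the
indicators of n - 1 ≤ m and n + 1 ≤ m, both zero for n > m + 1. -/
theorem fieldLin_cutoff (ξ : ℂ) {F : cutoffFun E} {m : ℕ} (hm : ∀ η, F.1 η ≠ 0 → η.num ≤ m) :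
    ∀ η, (fieldLin p α ξ F).1 η ≠ 0 → η.num ≤ m + 1 := by
  intro η hη
  by_contra! hcon
  have hF : F = weight (fun n => if n ≤ m then 1 else 0) F :=
    (weight_eq_self fun ζ hζ => if_pos (hm ζ hζ)).symm
  refine hη ?_
  rw [hF, fieldLin_apply, raise_weight, lower_weight]
  have h1 : ¬ η.num ≤ m + 1 := by omega
  have h2 : ¬ η.num < m := by omega
  simp [h1, h2]

/-! ### Slowly varying cutoffs and their commutators with the field operator. -/

/-- The cutoff function of the particle number: `1` up to `N + 1`, `0` from `2 (N + 1)` on, and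
linear in between. -/
noncomputable def ramp (N n : ℕ) : ℝ := max 0 (min 1 (2 - n / (N + 1)))

theorem ramp_nonneg (N n : ℕ) : 0 ≤ ramp N n := le_max_left _ _

theorem ramp_le_one (N n : ℕ) : ramp N n ≤ 1 := max_le zero_le_one (min_le_left _ _)

theorem ramp_eq_one {N n : ℕ} (h : n ≤ N + 1) : ramp N n = 1 := by
  have h1 : (n : ℝ) / (N + 1) ≤ 1 := (div_le_one (by positivity)).2 (by exact_mod_cast h)
  rw [ramp, min_eq_left (by linarith), max_eq_right zero_le_one]

theorem ramp_eq_zero {N n : ℕ} (h : 2 * (N + 1) ≤ n) : ramp N n = 0 := by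
  have h1 : 2 ≤ (n : ℝ) / (N + 1) := (le_div_iff₀ (by positivity)).2 (by exact_mod_cast h)
  rw [ramp, max_eq_left]
  exact (min_le_right _ _).trans (by linarith)

theorem abs_ramp_sub_le (N n : ℕ) : |ramp N (n + 1) - ramp N n| ≤ 1 / (N + 1) := by
  have h := (abs_max_sub_max_le_abs (min 1 (2 - (n + 1 : ℕ) / (N + 1 : ℝ)))
    (min 1 (2 - n / (N + 1 : ℝ))) 0)
  rw [ramp, ramp, max_comm 0, max_comm 0]
  refine h.trans ((abs_min_sub_min_le_max _ _ _ _).trans ?_)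
  have e : 2 - ((n + 1 : ℕ) : ℝ) / (N + 1 : ℝ) - (2 - n / (N + 1 : ℝ)) = -(1 / (N + 1)) := by
    push_cast; ring
  rw [e, abs_neg, sub_self, abs_zero, abs_of_nonneg (by positivity)]
  exact max_le (by positivity) le_rfl

/-- The squared slope 1/(N + 1)² beats the quadratic growth, because increments vanish from n = 2(N
+ 1) on. The bound does not depend on N, which is what the cutoff argument needs. -/
theorem ramp_sub_sq_mul_le {a : ℝ} (ha : 0 ≤ a) (N n : ℕ) :
    (ramp N (n + 1) - ramp N n) ^ 2 * ((n + 1) * (a + n)) ≤ (2 * (a + 2)) ^ 2 := by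
  by_cases hn : 2 * (N + 1) ≤ n
  · rw [ramp_eq_zero hn, ramp_eq_zero (hn.trans n.le_succ)]
    simp only [sub_self, ne_eq, OfNat.ofNat_ne_zero, not_false_eq_true, zero_pow, zero_mul]
    positivity
  · have hn' : (n : ℝ) + 1 ≤ 2 * (N + 1) := by exact_mod_cast (not_le.1 hn)
    have hN : (0 : ℝ) ≤ N := by positivity
    have h0 : (0 : ℝ) ≤ n := by positivity
    have h1 := abs_ramp_sub_le N n
    have h2 : a + n ≤ (a + 2) * (N + 1) := by nlinarith
    calc (ramp N (n + 1) - ramp N n) ^ 2 * ((n + 1) * (a + n))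
        ≤ (1 / (N + 1)) ^ 2 * ((2 * (N + 1)) * ((a + 2) * (N + 1))) := by
          rw [← sq_abs]
          gcongr
      _ = 2 * (a + 2) := by field_simp
      -- Squaring is affordable as 2(a + 2) ≥ 1, and gives the form c² used by the norm bounds.
      _ ≤ (2 * (a + 2)) ^ 2 := by nlinarith

/-- The commutator of the field operator with the cutoffs is bounded uniformly in the cutoff. -/
theorem norm_fieldLin_commutator_le (ξ : ℂ) (N : ℕ) (F : cutoffFun E) :
    ‖toL2 p α (fieldLin p α ξ (weight (ramp N) F) - weight (ramp N) (fieldLin p α ξ F))‖ ≤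
      4 * ‖ξ‖ * (α.real Set.univ + 2) * ‖toL2 p α F‖ := by
  have ha : 0 ≤ α.real Set.univ := measureReal_nonneg
  -- By the commutation rules the commutator is the field operator with both terms weighted by
  -- increments of the ramp.
  have e : fieldLin p α ξ (weight (ramp N) F) - weight (ramp N) (fieldLin p α ξ F) =
      (1 / Complex.I) •
        (ξ • weight (fun n => ramp N (n - 1) - ramp N n) (raiseLin p (one E) F) -
          conj ξ • weight (fun n => ramp N (n + 1) - ramp N n) (lowerLin p α (one E) F)) := by
    simp only [fieldLin_apply, raise_weight, lower_weight, weight_sub, map_smul, map_sub]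
    module
  have hc : 0 ≤ 2 * (α.real Set.univ + 2) := by positivity
  have h1 := norm_weight_raise_le p α (w := fun n => ramp N (n - 1) - ramp N n) hc (F := F)
    (fun η _ => by
      have := ramp_sub_sq_mul_le ha N η.num
      rwa [← neg_sq, neg_sub] at this)
  have h2 := norm_weight_lower_le p α (w := fun n => ramp N (n + 1) - ramp N n) hc (F := F)
    (fun η _ k _ => ramp_sub_sq_mul_le ha N k)
  rw [e]
  refine (norm_field_combination_le p α ξ _ _).trans ?_
  calc _ ≤ ‖ξ‖ * (2 * (α.real Set.univ + 2) * ‖toL2 p α F‖ +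
        2 * (α.real Set.univ + 2) * ‖toL2 p α F‖) := by gcongr
    _ = _ := by ring

/-! ### Self-adjointness of the closure. -/

theorem dense_domain_fieldOp (ξ : ℂ) : Dense ((fieldOp p α ξ).domain : Set (Hilb p α)) := by
  have h := denseRange_toL2 p α
  rw [DenseRange, ← LinearMap.coe_range] at h
  exact h

theorem fieldOp_toL2 (ξ : ℂ) (F : cutoffFun E) :
    fieldOp p α ξ ⟨toL2 p α F, F, rfl⟩ = toL2 p α (fieldLin p α ξ F) :=
  congrArg Subtype.val (fieldEnd_toL2 p α ξ F)

theorem fieldOp_symmetric (ξ : ℂ) : (fieldOp p α ξ).IsFormalAdjoint (fieldOp p α ξ) := by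
  rintro ⟨_, F, rfl⟩ ⟨_, G, rfl⟩
  rw [fieldOp_toL2, fieldOp_toL2]
  exact inner_fieldLin p α ξ F G

theorem adjoint_graph_fieldOp_le (ξ : ℂ) :
    (fieldOp p α ξ).adjoint.graph ≤ (fieldOp p α ξ).graph.topologicalClosure := by
  have hd := dense_domain_fieldOp p α ξ
  rintro ⟨g, h⟩ hgh
  have hgh' : ∀ F, inner ℂ h (toL2 p α F) = inner ℂ g (toL2 p α (fieldLin p α ξ F)) := by
    intro F
    rw [LinearPMap.adjoint_graph_eq_graph_adjoint hd, Submodule.mem_adjoint_iff] at hgh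
    have h1 := hgh (toL2 p α F) (toL2 p α (fieldLin p α ξ F)) (by
      rw [LinearPMap.mem_graph_iff]
      exact ⟨⟨toL2 p α F, F, rfl⟩, rfl, fieldOp_toL2 p α ξ F⟩)
    rw [← inner_conj_symm, ← inner_conj_symm g, ← sub_eq_zero.1 h1]
  refine Metric.mem_closure_iff.2 fun ε hε => ?_
  obtain ⟨F, hF1, hF2⟩ := exists_graph_approx_of_cutoff (toL2 p α) (denseRange_toL2 p α)
    (fieldLin p α ξ) (inner_fieldLin p α ξ) (fun N => weight (ramp N))
    (fun N => inner_weight p α (ramp N))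
    (fun N F => by
      simpa using norm_weight_le p α (c := 1) zero_le_one (F := F) fun η _ => by
        simpa using pow_le_one₀ (n := 2) (ramp_nonneg N η.num) (ramp_le_one N η.num))
    (fun F => by
      obtain ⟨m, hm⟩ := exists_cutoff F
      filter_upwards [Filter.eventually_ge_atTop m] with N hN
      exact weight_eq_self fun η hη => ramp_eq_one (by have := hm η hη; omega))
    -- After the cutoff at most 2(N + 1) points remain, so this is the growth bound with m = 2(N +
    -- 1).
    (fun N => 2 * ‖ξ‖ * (α.real Set.univ + 1) * ((2 * (N + 1) : ℕ) + 1))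
    (fun N F => by
      have h1 := norm_fieldLin_le p α ξ (F := weight (ramp N) F) (m := 2 * (N + 1))
        (fun η hη => by
          by_contra! hcon
          exact hη (by simp [ramp_eq_zero hcon.le]))
      refine h1.trans ?_
      gcongr
      simpa using norm_weight_le p α (c := 1) zero_le_one (F := F) fun η _ => by
        simpa using pow_le_one₀ (n := 2) (ramp_nonneg N η.num) (ramp_le_one N η.num))
    (4 * ‖ξ‖ * (α.real Set.univ + 2)) (by positivity)
    (norm_fieldLin_commutator_le p α ξ) hgh' hε
  refine ⟨(toL2 p α F, toL2 p α (fieldLin p α ξ F)), ?_, ?_⟩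
  · exact (LinearPMap.mem_graph_iff _).2 ⟨⟨toL2 p α F, F, rfl⟩, rfl, fieldOp_toL2 p α ξ F⟩
  · rw [Prod.dist_eq, max_lt_iff, dist_comm, dist_eq_norm, dist_comm, dist_eq_norm]
    exact ⟨hF1, hF2⟩

/-! ### Analytic vectors. -/

/-- Support and norm are controlled together: after n applications the cutoff is m + n, so the next
one costs a factor proportional to m + n + 1, and the product of these is a rising factorial. -/
theorem norm_fieldLin_pow_le (ξ : ℂ) {F : cutoffFun E} {m : ℕ}
    (hm : ∀ η, F.1 η ≠ 0 → η.num ≤ m) (n : ℕ) :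
    (∀ η, ((fieldLin p α ξ ^ n) F).1 η ≠ 0 → η.num ≤ m + n) ∧
    ‖toL2 p α ((fieldLin p α ξ ^ n) F)‖ ≤
      (2 * ‖ξ‖ * (α.real Set.univ + 1)) ^ n * (m + 1).ascFactorial n * ‖toL2 p α F‖ := by
  induction n with
  | zero => exact ⟨hm, by simp⟩
  | succ n ih =>
    have e : (fieldLin p α ξ ^ (n + 1)) F = fieldLin p α ξ ((fieldLin p α ξ ^ n) F) := by
      rw [pow_succ', Module.End.mul_apply]
    rw [e]
    refine ⟨fieldLin_cutoff p α ξ ih.1, (norm_fieldLin_le p α ξ ih.1).trans ?_⟩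
    refine (mul_le_mul_of_nonneg_left ih.2 (by positivity)).trans_eq ?_
    rw [Nat.ascFactorial_succ, pow_succ]
    push_cast
    ring

theorem exists_summable_fieldEnd_pow (ξ : ℂ) (f : dom p α) : ∃ ε : ℝ, 0 < ε ∧
    Summable fun n : ℕ => ε ^ n / n.factorial * ‖(fieldEnd p α ξ ^ n) f‖ := by
  obtain ⟨_, F, rfl⟩ := f
  obtain ⟨m, hm⟩ := exists_cutoff F
  set K := 2 * ‖ξ‖ * (α.real Set.univ + 1) with hK
  have hK0 : 0 ≤ K := by positivity
  -- The ratio becomes K/(K + 1) < 1, also when K = 0.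
  refine ⟨1 / (K + 1), by positivity, ?_⟩
  have hr0 : 0 ≤ K / (K + 1) := by positivity
  have hr : ‖K / (K + 1)‖ < 1 := by
    rw [Real.norm_of_nonneg hr0, div_lt_one (by positivity)]
    linarith
  refine Summable.of_nonneg_of_le (fun n => by positivity) (fun n => ?_)
    ((summable_choose_mul_geometric_of_norm_lt_one m hr).mul_right ‖toL2 p α F‖)
  rw [fieldEnd_pow_toL2]
  refine (mul_le_mul_of_nonneg_left (norm_fieldLin_pow_le p α ξ hm n).2 (by positivity)).trans_eq ?_
  -- Division by n! leaves a binomial coefficient of fixed lower index m, polynomial in n, so the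
  -- geometric factor wins.
  have h1 : ((m + 1).ascFactorial n : ℝ) = n.factorial * (n + m).choose m := by
    rw [Nat.ascFactorial_eq_factorial_mul_choose, Nat.add_comm n m,
      Nat.choose_symm_add]
    push_cast; rfl
  rw [h1, ← hK, div_pow, div_pow, one_pow]
  field_simp

end Field

end Pascal

theorem lemma4p2 {E : Type*} [MeasurableSpace E] [StandardBorelSpace E]
    (p : Set.Ioo (0 : ℝ) 1) (α : MeasureTheory.Measure E) [MeasureTheory.IsFiniteMeasure α]
    (ξ : ℂ) :
    (Pascal.fieldOp p α ξ).IsClosable ∧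
      IsSelfAdjoint (Pascal.fieldOp p α ξ).closure ∧
      ∀ f : Pascal.dom p α, ∃ ε : ℝ, 0 < ε ∧
        Summable fun n : ℕ => ε ^ n / n.factorial * ‖(Pascal.fieldEnd p α ξ ^ n) f‖ :=
  ⟨LinearPMap.isClosable_of_symmetric (Pascal.dense_domain_fieldOp p α ξ)
      (Pascal.fieldOp_symmetric p α ξ),
    LinearPMap.isSelfAdjoint_closure_of_adjoint_graph_le (Pascal.dense_domain_fieldOp p α ξ)
      (Pascal.fieldOp_symmetric p α ξ) (Pascal.adjoint_graph_fieldOp_le p α ξ),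
    Pascal.exists_summable_fieldEnd_pow p α ξ⟩
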